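/- Let $n\ge 1$ and $s\in(0,1)$. There is a constant $\Theta=\Theta(n,s)>1$ such that the following holds for every bounded open set $\Omega\subset\mathbb R^n$ with Lipschitz boundary, where $\mathcal C\Omega:=\mathbb R^n\setminus\Omega$, $d:=\operatorname{diam}(\Omega)$, $\Omega_r:=\{y\in\mathbb R^n : \operatorname{dist}(y,\Omega)<r\}$ and $Q(\Omega):=\mathbb R^{2n}\setminus(\mathcal C\Omega)^2$. Definitions. $\mathcal W^s(\Omega)$ is the set of measurable $u:\mathbb R^n\to\mathbb R$ with $u\in L^1(\Omega)$ and $\int_\Omega\int_\Omega\frac{|u(x)-u(y)|}{|x-y|^{n+s}}\,dx\,dy<\infty$. A function $u\in\mathcal W^s(\Omega)$ is *$s$-minimal in $\Omega$* if, for every $v\in\mathcal W^s(\Omega)$ with $v=u$ a.e. in $\mathcal C\Omega$, the integral $$\iint_{Q(\Omega)}\big(|u(x)-u(y)|-|v(x)-v(y)|\big)\frac{dx\,dy}{|x-y|^{n+s}}$$ converges absolutely and is $\le 0$. For measurable $E\subset\mathbb R^n$ put $\operatorname{Per}_s(E,\Omega):=\frac12\iint_{Q(\Omega)}\frac{|\chi_E(x)-\chi_E(y)|}{|x-y|^{n+s}}\,dx\,dy$.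 The set $E$ is *$s$-minimal in $\Omega$ with respect to $E_0$* if $E\setminus\Omega=E_0\setminus\Omega$, $\operatorname{Per}_s(E,\Omega)<\infty$, and $\operatorname{Per}_s(E,\Omega)\le\operatorname{Per}_s(F,\Omega)$ for all measurable $F$ with $F\setminus\Omega=E\setminus\Omega$; it is *maximal* if $|E\cap\Omega|$ is the largest among all $s$-minimal sets in $\Omega$ with respect to $E_0$. The closure $\overline E$ of a measurable set is understood in the measure-theoretic sense (independently of modifications of $E$ on null sets): $x\in\overline E$ if and only if $|E\cap B_r(x)|>0$ for all $r>0$. Claim. Let $\varphi:\mathcal C\Omega\to\mathbb R$ be measurable with $\varphi\in L^\infty(\Omega_{\Theta d}\setminus\Omega)$. Then there exists an $s$-minimal function $u\in\mathcal W^s(\Omega)$ in $\Omega$ with $u=\varphi$ in $\mathcal C\Omega$. Moreover, for every $t\in\mathbb R$ there is a maximal $s$-minimal set in $\Omega$ with respect to $\{x\in\mathcal C\Omega:\varphi(x)\ge t\}$, and, for every choice of such sets $E_t$, $t\in\mathbb R$, this $u$ is given by $$u(x)=\sup\{t\in\mathbb R : x\in\overline{E_t}\}\qquad\text{for every }x\in\Omega,$$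 where the set on the right-hand side is nonempty and bounded above. -/

import Mathlib

open MeasureTheory Set Metric

/-- `Ω` has Lipschitz boundary: near each boundary point, for a suitable unit vector `ν` (the last
coordinate direction), `Ω` is the region strictly above the graph of a Lipschitz function defined on
the hyperplane orthogonal to `ν`. -/
def HasLipschitzBoundary {n : ℕ} (Ω : Set (EuclideanSpace ℝ (Fin n))) : Prop :=
  ∀ p ∈ frontier Ω, ∃ ν : EuclideanSpace ℝ (Fin n), ‖ν‖ = 1 ∧
    ∃ (g : (Submodule.span ℝ {ν})ᗮ → ℝ) (K : NNReal), LipschitzWith K g ∧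
      ∃ r > 0, ∀ x ∈ ball p r,
        (x ∈ Ω ↔ g ((Submodule.span ℝ {ν})ᗮ.orthogonalProjectionOnto x) < inner ℝ ν x)

/-- `Q(Ω)`: the pairs `(x, y)` that are not both in the complement of `Ω`. -/
def crossRegion {n : ℕ} (Ω : Set (EuclideanSpace ℝ (Fin n))) :
    Set (EuclideanSpace ℝ (Fin n) × EuclideanSpace ℝ (Fin n)) :=
  (Ωᶜ ×ˢ Ωᶜ)ᶜ

/-- The Gagliardo seminorm `[u]_{W^{s,1}(Ω)}`, with values in `[0, ∞]`. -/
noncomputable def gagliardoSeminorm {n : ℕ} (s : ℝ) (Ω : Set (EuclideanSpace ℝ (Fin n)))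
    (u : EuclideanSpace ℝ (Fin n) → ℝ) : ENNReal :=
  ∫⁻ x in Ω, ∫⁻ y in Ω, ENNReal.ofReal (|u x - u y| / ‖x - y‖ ^ ((n : ℝ) + s))

/-- The space `𝒲^s(Ω)`: (Lebesgue) measurable functions on the whole of `ℝⁿ` whose restriction to
`Ω` belongs to `W^{s,1}(Ω)`. -/
def MemWs {n : ℕ} (s : ℝ) (Ω : Set (EuclideanSpace ℝ (Fin n)))
    (u : EuclideanSpace ℝ (Fin n) → ℝ) : Prop :=
  AEMeasurable u volume ∧ IntegrableOn u Ω volume ∧ gagliardoSeminorm s Ω u < ⊤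

/-- `u` is an `s`-minimal function in `Ω`. The double integral over `Q(Ω)` is required to converge
absolutely, so that its sign is meaningful. -/
def IsSMinimalFunction {n : ℕ} (s : ℝ) (Ω : Set (EuclideanSpace ℝ (Fin n)))
    (u : EuclideanSpace ℝ (Fin n) → ℝ) : Prop :=
  MemWs s Ω u ∧
    ∀ v : EuclideanSpace ℝ (Fin n) → ℝ, MemWs s Ω v →
      (∀ᵐ x ∂(volume.restrict Ωᶜ), u x = v x) →
      IntegrableOn
        (fun p : EuclideanSpace ℝ (Fin n) × EuclideanSpace ℝ (Fin n) =>
          (|u p.1 - u p.2| - |v p.1 - v p.2|) / ‖p.1 - p.2‖ ^ ((n : ℝ) + s))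
        (crossRegion Ω) volume ∧
      ∫ p in crossRegion Ω,
        (|u p.1 - u p.2| - |v p.1 - v p.2|) / ‖p.1 - p.2‖ ^ ((n : ℝ) + s) ≤ 0

/-- The `s`-fractional perimeter of `E` in `Ω`, with values in `[0, ∞]`. -/
noncomputable def fracPerimeter {n : ℕ} (s : ℝ) (E Ω : Set (EuclideanSpace ℝ (Fin n))) : ENNReal :=
  (1 / 2) * ∫⁻ p in crossRegion Ω,
    ENNReal.ofReal
      (|E.indicator (fun _ => (1 : ℝ)) p.1 - E.indicator (fun _ => (1 : ℝ)) p.2| /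
        ‖p.1 - p.2‖ ^ ((n : ℝ) + s))

/-- The (Lebesgue measurable) set `E` is `s`-minimal in `Ω`. -/
def IsSMinimalSet {n : ℕ} (s : ℝ) (Ω E : Set (EuclideanSpace ℝ (Fin n))) : Prop :=
  NullMeasurableSet E volume ∧ fracPerimeter s E Ω < ⊤ ∧
    ∀ F : Set (EuclideanSpace ℝ (Fin n)), NullMeasurableSet F volume → F \ Ω = E \ Ω →
      fracPerimeter s E Ω ≤ fracPerimeter s F Ω

/-- `E` is `s`-minimal in `Ω` with respect to the exterior datum `E₀`. -/
def IsSMinimalSetWrt {n : ℕ} (s : ℝ) (Ω E₀ E : Set (EuclideanSpace ℝ (Fin n))) : Prop :=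
  IsSMinimalSet s Ω E ∧ E \ Ω = E₀ \ Ω

/-- `E` is a maximal `s`-minimal set in `Ω` with respect to `E₀`: it has the largest volume inside
`Ω` among all `s`-minimal sets with the exterior datum `E₀`. -/
def IsMaximalSMinimalSet {n : ℕ} (s : ℝ) (Ω E₀ E : Set (EuclideanSpace ℝ (Fin n))) : Prop :=
  IsSMinimalSetWrt s Ω E₀ E ∧
    ∀ F : Set (EuclideanSpace ℝ (Fin n)), IsSMinimalSetWrt s Ω E₀ F →
      volume (F ∩ Ω) ≤ volume (E ∩ Ω)

/-- The measure-theoretic closure of `E`: the points all of whose balls meet `E` in positive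
measure. It does not change when `E` is changed by a null set, it is contained in the topological
closure of `E`, and it is equal to it for a representative of `E` that has no negligible parts. -/
def measureClosure {n : ℕ} (E : Set (EuclideanSpace ℝ (Fin n))) :
    Set (EuclideanSpace ℝ (Fin n)) :=
  {x | ∀ r > 0, 0 < volume (E ∩ ball x r)}

namespace FractionalPerimeter
open Filter
open scoped ENNReal NNReal Topology
variable {n : ℕ} {s : ℝ}
local notation "𝔼" => EuclideanSpace ℝ (Fin n)

/-! By the coarea formula, the integral of |u(x) - u(y)| |x - y|^{-n-s} over Q(Ω) is the integral
over t of twice the s-perimeter of {u ≥ t}. A function whose superlevel sets are s-minimal should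
therefore be s-minimal, and the task is to find nested minimal sets E_t with data {φ ≥ t} and to
stack them.

Sets. The perimeter is submodular, and this takes the place of compactness: it yields minimizers
(`exists_isSMinimalSetWrt`), stability of minimality under countable unions, hence maximal
minimizers, and comparison: maximal sets decrease in t up to null sets
(`IsMaximalSMinimalSet.measure_diff_eq_zero`). A minimal set whose datum is null in a wide collar of
Ω has no mass in Ω (`IsSMinimalSet.measure_inter_eq_zero`). If |φ| ≤ M in the collar, this applies
to E_t for t > M and to its complement for t ≤ -M, so the supremum defining u is finite and |u| ≤ M
in Ω. The density estimate identifies E_t with its measure-theoretic closure almost everywhere in Ω,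
so that {u ≥ t} = E_t a.e. for all but countably many t.

Functions. Far from Ω the datum φ is arbitrary, so the energies of u and of a competitor v over Q(Ω)
may both be infinite and only their difference makes sense. On Ω × Ωᶜ the difference of the
integrands is at most |u(x) - v(x)| |x - y|^{-n-s}, which is integrable by a fractional Hardy
inequality (`lintegral_mul_interaction_compl_ne_top`); this uses the Lipschitz boundary and s < 1.
The coarea formula is applied to truncations, whose energies are finite, and dominated convergence
removes the truncation (`energyDiff_integrableOn_and_nonpos`). -/

/-! ### The kernel and the interaction measure -/

/-- The kernel `|z|^{-n-s}`, with values in `[0, ∞]`. -/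
noncomputable def fracKernel (n : ℕ) (s : ℝ) (z : EuclideanSpace ℝ (Fin n)) : ℝ≥0∞ :=
  ENNReal.ofReal (1 / ‖z‖ ^ ((n : ℝ) + s))

@[fun_prop]
lemma measurable_fracKernel : Measurable (fracKernel n s) := by
  unfold fracKernel
  fun_prop

lemma fracKernel_neg (z : 𝔼) : fracKernel n s (-z) = fracKernel n s z := by
  simp [fracKernel]

/-- The measure `|x - y|^{-n-s} dx dy`. -/
noncomputable def interactionMeasure (n : ℕ) (s : ℝ) :
    Measure (EuclideanSpace ℝ (Fin n) × EuclideanSpace ℝ (Fin n)) :=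
  volume.withDensity fun p => fracKernel n s (p.1 - p.2)

lemma measurable_fracKernel_sub :
    Measurable fun p : 𝔼 × 𝔼 => fracKernel n s (p.1 - p.2) := by
  fun_prop

lemma interactionMeasure_apply (S : Set (𝔼 × 𝔼)) :
    interactionMeasure n s S = ∫⁻ p in S, fracKernel n s (p.1 - p.2) := by
  rw [interactionMeasure, Measure.volume_eq_prod, withDensity_apply']

lemma interactionMeasure_prod (A B : Set 𝔼) :
    interactionMeasure n s (A ×ˢ B) = ∫⁻ x in A, ∫⁻ y in B, fracKernel n s (x - y) := by
  rw [interactionMeasure_apply, Measure.volume_eq_prod, ← Measure.prod_restrict,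
    lintegral_prod _ measurable_fracKernel_sub.aemeasurable]

lemma interactionMeasure_absolutelyContinuous :
    interactionMeasure n s ≪ (volume : Measure (𝔼 × 𝔼)) :=
  withDensity_absolutelyContinuous _ _

lemma interactionMeasure_swap (S : Set (𝔼 × 𝔼)) :
    interactionMeasure n s (Prod.swap ⁻¹' S) = interactionMeasure n s S := by
  have h : MeasurePreserving (MeasurableEquiv.prodComm : 𝔼 × 𝔼 ≃ᵐ 𝔼 × 𝔼) volume volume :=
    Measure.measurePreserving_swap
  rw [interactionMeasure_apply, interactionMeasure_apply,
    ← h.setLIntegral_comp_preimage_emb (MeasurableEquiv.measurableEmbedding _)]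
  refine lintegral_congr fun p => ?_
  rw [← fracKernel_neg, neg_sub]
  rfl

lemma interactionMeasure_prod_comm (A B : Set 𝔼) :
    interactionMeasure n s (A ×ˢ B) = interactionMeasure n s (B ×ˢ A) := by
  rw [← interactionMeasure_swap, preimage_swap_prod]

lemma nullMeasurableSet_prod {A B : Set 𝔼} (hA : NullMeasurableSet A volume)
    (hB : NullMeasurableSet B volume) :
    NullMeasurableSet (A ×ˢ B) (interactionMeasure n s) :=
  (NullMeasurableSet.prod hA hB).mono_ac interactionMeasure_absolutelyContinuous

/-! ### Kernel tails and the isoperimetric inequality -/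

lemma lintegral_comp_smul {E : Type*} [NormedAddCommGroup E] [NormedSpace ℝ E]
    [MeasurableSpace E] [BorelSpace E] [FiniteDimensional ℝ E] (μ : Measure E)
    [μ.IsAddHaarMeasure] (f : E → ℝ≥0∞) {r : ℝ} (hr : r ≠ 0) :
    ∫⁻ x, f (r • x) ∂μ = ENNReal.ofReal |(r ^ Module.finrank ℝ E)⁻¹| * ∫⁻ x, f x ∂μ := by
  have h := lintegral_map_equiv (μ := μ) f (MeasurableEquiv.smul₀ r hr)
  simp only [MeasurableEquiv.coe_smul₀] at h
  rw [← h, Measure.map_addHaar_smul μ hr, lintegral_smul_measure, smul_eq_mul]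

/-- The integral of `|z|^{-n-s}` over the complement of the ball of radius `ρ`. -/
noncomputable def kernelTail (n : ℕ) (s ρ : ℝ) : ℝ≥0∞ :=
  ∫⁻ z in {z : EuclideanSpace ℝ (Fin n) | ρ ≤ ‖z‖}, fracKernel n s z

lemma measurableSet_le_norm (ρ : ℝ) : MeasurableSet {z : 𝔼 | ρ ≤ ‖z‖} :=
  measurableSet_le measurable_const measurable_norm

/-- The substitution z ↦ ρz: the kernel is homogeneous of degree -(n+s) and the volume scales by
ρ^n. This exact scaling fixes Θ and produces every power -s below. -/
lemma kernelTail_eq {ρ : ℝ} (hρ : 0 < ρ) :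
    kernelTail n s ρ = ENNReal.ofReal (ρ ^ (-s)) * kernelTail n s 1 := by
  have h := lintegral_comp_smul (volume : Measure 𝔼)
    ({z : 𝔼 | ρ ≤ ‖z‖}.indicator (fracKernel n s)) hρ.ne'
  rw [lintegral_indicator (measurableSet_le_norm ρ), finrank_euclideanSpace_fin] at h
  have h2 : ∀ z : 𝔼, {z : 𝔼 | ρ ≤ ‖z‖}.indicator (fracKernel n s) (ρ • z) =
      ENNReal.ofReal (ρ ^ (-((n : ℝ) + s))) *
        {z : 𝔼 | 1 ≤ ‖z‖}.indicator (fracKernel n s) z := by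
    intro z
    have e : ‖ρ • z‖ = ρ * ‖z‖ := by rw [norm_smul, Real.norm_of_nonneg hρ.le]
    by_cases hz : 1 ≤ ‖z‖
    · have hz' : ρ ≤ ‖ρ • z‖ := by rw [e]; nlinarith
      rw [indicator_of_mem (by exact hz'), indicator_of_mem (by exact hz), fracKernel, fracKernel,
        ← ENNReal.ofReal_mul (by positivity), e, Real.mul_rpow hρ.le (norm_nonneg _),
        Real.rpow_neg hρ.le]
      congr 1
      field_simp
    · have hz' : ¬ ρ ≤ ‖ρ • z‖ := by rw [e]; push Not at hz ⊢; nlinarith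
      rw [indicator_of_notMem (by exact hz'), indicator_of_notMem (by exact hz), mul_zero]
  simp_rw [h2] at h
  rw [lintegral_const_mul' _ _ ENNReal.ofReal_ne_top,
    lintegral_indicator (measurableSet_le_norm 1)] at h
  change ENNReal.ofReal (ρ ^ (-((n : ℝ) + s))) * kernelTail n s 1 = _ * kernelTail n s ρ at h
  have h3 : ENNReal.ofReal (ρ ^ n) * ENNReal.ofReal |(ρ ^ n)⁻¹| = 1 := by
    rw [← ENNReal.ofReal_mul (by positivity), abs_of_pos (by positivity),
      mul_inv_cancel₀ (by positivity), ENNReal.ofReal_one]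
  calc kernelTail n s ρ = ENNReal.ofReal (ρ ^ n) *
        (ENNReal.ofReal |(ρ ^ n)⁻¹| * kernelTail n s ρ) := by rw [← mul_assoc, h3, one_mul]
    _ = _ := by
      rw [← h, ← mul_assoc, ← ENNReal.ofReal_mul (by positivity), ← Real.rpow_natCast,
        ← Real.rpow_add hρ]
      congr 3
      ring

lemma kernelTail_one_ne_top (hs : 0 < s) : kernelTail n s 1 ≠ ⊤ := by
  have hint : Integrable (fun z : 𝔼 => (1 + ‖z‖) ^ (-((n : ℝ) + s))) volume :=
    integrable_one_add_norm (by rw [finrank_euclideanSpace_fin]; linarith)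
  have hr : (0 : ℝ) ≤ (n : ℝ) + s := by positivity
  refine ne_top_of_le_ne_top (hint.const_mul (2 ^ ((n : ℝ) + s))).lintegral_lt_top.ne ?_
  refine (setLIntegral_mono' (measurableSet_le_norm 1) fun z hz => ?_).trans
    (setLIntegral_le_lintegral _ _)
  refine ENNReal.ofReal_le_ofReal ?_
  have hz : 1 ≤ ‖z‖ := hz
  rw [Real.rpow_neg (by positivity), ← div_eq_mul_inv, div_le_div_iff₀ (by positivity)
    (by positivity), one_mul, ← Real.mul_rpow (by positivity) (by positivity)]
  exact Real.rpow_le_rpow (by positivity) (by linarith) hr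

lemma kernelTail_ne_top (hs : 0 < s) {ρ : ℝ} (hρ : 0 < ρ) : kernelTail n s ρ ≠ ⊤ := by
  rw [kernelTail_eq hρ]
  exact ENNReal.mul_ne_top ENNReal.ofReal_ne_top (kernelTail_one_ne_top hs)

lemma kernelTail_one_ne_zero (hn : 1 ≤ n) : kernelTail n s 1 ≠ 0 := by
  have : Nontrivial 𝔼 := by
    have : Nonempty (Fin n) := ⟨⟨0, hn⟩⟩
    infer_instance
  refine (((setLIntegral_pos_iff measurable_fracKernel).2 ?_)).ne'
  obtain ⟨z, hz⟩ := NormedSpace.exists_lt_norm ℝ 𝔼 1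
  have ho : IsOpen {z : 𝔼 | 1 < ‖z‖} := isOpen_lt continuous_const continuous_norm
  refine (ho.measure_pos volume ⟨z, hz⟩).trans_le (measure_mono fun w hw => ⟨?_, ?_⟩)
  · have hw : 1 < ‖w‖ := hw
    simp only [Function.mem_support, fracKernel]
    exact (ENNReal.ofReal_pos.2 (by positivity)).ne'
  · exact (show 1 < ‖w‖ from hw).le

lemma lintegral_fracKernel_far (x : 𝔼) (ρ : ℝ) :
    ∫⁻ y in {y | ρ ≤ ‖x - y‖}, fracKernel n s (x - y) = kernelTail n s ρ := by
  have hm : MeasurableSet {y : 𝔼 | ρ ≤ ‖x - y‖} := measurableSet_le measurable_const (by fun_prop)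
  rw [kernelTail, ← lintegral_indicator (measurableSet_le_norm ρ), ← lintegral_indicator hm,
    ← lintegral_sub_left_eq_self ({z : 𝔼 | ρ ≤ ‖z‖}.indicator (fracKernel n s)) x]
  rfl

lemma lintegral_fracKernel_le_tail {x : 𝔼} {ρ : ℝ} {B : Set 𝔼}
    (hB : ∀ᵐ y, y ∈ B → ρ ≤ ‖x - y‖) :
    ∫⁻ y in B, fracKernel n s (x - y) ≤ kernelTail n s ρ := by
  rw [← lintegral_fracKernel_far x ρ]
  exact lintegral_mono_set' hB

/-- A fractional isoperimetric inequality. -/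
lemma exists_isoperimetric (hn : 1 ≤ n) (hs₀ : 0 < s) (hs₁ : s < 1) :
    ∃ c : ℝ, 0 < c ∧ ∀ A : Set 𝔼, NullMeasurableSet A volume → volume A ≠ ⊤ →
      ENNReal.ofReal (c * (volume A).toReal ^ (1 - s / n)) ≤
        interactionMeasure n s (A ×ˢ Aᶜ) := by
  have hn' : (1 : ℝ) ≤ n := by exact_mod_cast hn
  set ω : ℝ := (volume (ball (0 : 𝔼) 1)).toReal with hω
  have hω0 : 0 < ω := ENNReal.toReal_pos (measure_ball_pos _ _ one_pos).ne' measure_ball_lt_top.ne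
  refine ⟨(2 / ω) ^ (-(1 + s / n)), by positivity, fun A hA hAt => ?_⟩
  have hsn : s / n < 1 := (div_lt_one (by linarith)).2 (by linarith)
  rcases eq_or_lt_of_le (ENNReal.toReal_nonneg (a := volume A)) with h0 | hV
  · rw [← h0, Real.zero_rpow (by linarith)]; simp
  set V := (volume A).toReal with hVdef
  have hAV : volume A = ENNReal.ofReal V := (ENNReal.ofReal_toReal hAt).symm
  -- The radius for which a ball has volume 2|A|: at least |A| of any such ball lies outside A, and
  -- there the kernel is at least R^{-n-s}.
  set R : ℝ := (2 * V / ω) ^ (1 / (n : ℝ)) with hR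
  have hR0 : 0 < R := by positivity
  have hRn : R ^ n = 2 * V / ω := by
    rw [hR, ← Real.rpow_natCast, ← Real.rpow_mul (by positivity), one_div,
      inv_mul_cancel₀ (by linarith), Real.rpow_one]
  have key : ∀ x : 𝔼, ENNReal.ofReal (R ^ (-((n : ℝ) + s)) * V) ≤
      ∫⁻ y in Aᶜ, fracKernel n s (x - y) := by
    intro x
    have hball : volume (ball x R) = ENNReal.ofReal (2 * V) := by
      rw [Measure.addHaar_ball_of_pos volume x hR0, finrank_euclideanSpace_fin, hRn,
        ← ENNReal.ofReal_toReal measure_ball_lt_top.ne, ← hω, ← ENNReal.ofReal_mul (by positivity)]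
      congr 1
      field_simp
    have hdiff : ENNReal.ofReal V ≤ volume (ball x R \ A) := by
      have h1 : volume (ball x R) ≤ volume (ball x R \ A) + volume A :=
        (measure_mono (by intro y hy; by_cases h : y ∈ A <;> simp [h, hy])).trans
          (measure_union_le _ _)
      rw [hball, hAV, two_mul, ENNReal.ofReal_add hV.le hV.le] at h1
      exact (ENNReal.add_le_add_iff_right ENNReal.ofReal_ne_top).1 h1
    calc ENNReal.ofReal (R ^ (-((n : ℝ) + s)) * V)
        ≤ ENNReal.ofReal (R ^ (-((n : ℝ) + s))) * volume (ball x R \ A) := by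
          rw [ENNReal.ofReal_mul (by positivity)]; gcongr
      _ = ∫⁻ y in ball x R \ A, ENNReal.ofReal (R ^ (-((n : ℝ) + s))) := by
          rw [setLIntegral_const]
      _ ≤ ∫⁻ y in ball x R \ A, fracKernel n s (x - y) := by
          have hmeas : NullMeasurableSet (ball x R \ A) volume :=
            measurableSet_ball.nullMeasurableSet.diff hA
          -- At y = x the kernel has the default value 0, so the lower bound fails there.
          have hne : ∀ᵐ y : 𝔼, y ≠ x := by
            have : Nonempty (Fin n) := ⟨⟨0, hn⟩⟩
            exact Measure.ae_ne volume x
          refine lintegral_mono_ae ?_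
          filter_upwards [ae_restrict_mem₀ hmeas, ae_restrict_of_ae hne] with y hy hyx
          refine ENNReal.ofReal_le_ofReal ?_
          have hd : ‖x - y‖ ≤ R := by
            have := mem_ball'.1 hy.1
            rw [dist_eq_norm] at this
            exact this.le
          have hpos : 0 < ‖x - y‖ := norm_pos_iff.2 (sub_ne_zero.2 hyx.symm)
          rw [Real.rpow_neg hR0.le, ← one_div]
          gcongr
      _ ≤ _ := lintegral_mono_set fun y hy => hy.2
  rw [interactionMeasure_prod]
  calc ENNReal.ofReal ((2 / ω) ^ (-(1 + s / n)) * V ^ (1 - s / n))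
      = ENNReal.ofReal (R ^ (-((n : ℝ) + s)) * V) * volume A := by
        rw [hAV, ← ENNReal.ofReal_mul (by positivity)]
        congr 1
        have e1 : R ^ (-((n : ℝ) + s)) = (2 / ω) ^ (-(1 + s / n)) * V ^ (-(1 + s / n)) := by
          rw [hR, ← Real.rpow_mul (by positivity), ← Real.mul_rpow (by positivity) hV.le]
          congr 1
          · ring
          · field_simp
        rw [e1, show (1 - s / n : ℝ) = -(1 + s / n) + 1 + 1 by ring, Real.rpow_add_one hV.ne',
          Real.rpow_add_one hV.ne']
        ring
    _ = ∫⁻ x in A, ENNReal.ofReal (R ^ (-((n : ℝ) + s)) * V) := by rw [setLIntegral_const]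
    _ ≤ _ := lintegral_mono key

/-! ### The energy of a set: symmetry, submodularity, semicontinuity -/

lemma inter_sdiff {α : Type*} (A B C : Set α) : (A ∩ B) \ C = A \ C ∩ (B \ C) := by
  ext x
  simp only [Set.mem_sdiff, mem_inter_iff]
  tauto

lemma measurableSet_crossRegion {Ω : Set 𝔼} (hΩ : IsOpen Ω) : MeasurableSet (crossRegion Ω) :=
  (hΩ.measurableSet.compl.prod hΩ.measurableSet.compl).compl

/-- The interaction of `E` with its complement over the pairs in `Q(Ω)`. -/
noncomputable def energy {n : ℕ} (s : ℝ) (Ω E : Set (EuclideanSpace ℝ (Fin n))) : ℝ≥0∞ :=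
  interactionMeasure n s (crossRegion Ω ∩ E ×ˢ Eᶜ)

lemma energy_compl {Ω E : Set 𝔼} : energy s Ω Eᶜ = energy s Ω E := by
  rw [energy, ← interactionMeasure_swap, energy]
  congr 1
  ext p
  simp only [crossRegion, mem_preimage, mem_inter_iff, mem_compl_iff, mem_prod, Prod.fst_swap,
    Prod.snd_swap]
  tauto

lemma ofReal_abs_indicator_sub_div (E : Set 𝔼) (p : 𝔼 × 𝔼) :
    ENNReal.ofReal
      (|E.indicator (fun _ => (1 : ℝ)) p.1 - E.indicator (fun _ => (1 : ℝ)) p.2| /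
        ‖p.1 - p.2‖ ^ ((n : ℝ) + s)) =
    (E ×ˢ Eᶜ ∪ Eᶜ ×ˢ E).indicator (fun p => fracKernel n s (p.1 - p.2)) p := by
  by_cases h1 : p.1 ∈ E <;> by_cases h2 : p.2 ∈ E <;> simp [indicator, h1, h2, fracKernel]

lemma fracPerimeter_eq_energy {Ω E : Set 𝔼} (hΩ : IsOpen Ω) (hE : NullMeasurableSet E volume) :
    fracPerimeter s E Ω = energy s Ω E := by
  have h1 : NullMeasurableSet (E ×ˢ Eᶜ) (volume : Measure (𝔼 × 𝔼)) := hE.prod hE.compl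
  have h2 : NullMeasurableSet (Eᶜ ×ˢ E) (volume : Measure (𝔼 × 𝔼)) := hE.compl.prod hE
  rw [fracPerimeter]
  simp_rw [ofReal_abs_indicator_sub_div]
  rw [setLIntegral_indicator₀ _ ((h1.union h2).mono_ac Measure.absolutelyContinuous_restrict),
    ← interactionMeasure_apply, inter_comm, inter_union_distrib_left,
    measure_union₀ (((measurableSet_crossRegion hΩ).nullMeasurableSet).inter
      (nullMeasurableSet_prod hE.compl hE))]
  · have : interactionMeasure n s (crossRegion Ω ∩ Eᶜ ×ˢ E) = energy s Ω E := by
      rw [← energy_compl, energy, compl_compl]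
    rw [this, ← energy, ← two_mul, ← mul_assoc, one_div,
      ENNReal.inv_mul_cancel two_ne_zero ENNReal.ofNat_ne_top, one_mul]
  · refine Disjoint.aedisjoint (disjoint_left.2 fun p hp hp' => hp'.2.1 hp.2.1)

lemma energy_congr {Ω E F : Set 𝔼} (h : E =ᵐ[volume] F) : energy s Ω E = energy s Ω F := by
  have h1 : ∀ᵐ p : 𝔼 × 𝔼, (p.1 ∈ E ↔ p.1 ∈ F) := by
    rw [Measure.volume_eq_prod]
    exact Measure.quasiMeasurePreserving_fst.ae (h.mono fun x hx => iff_of_eq hx)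
  have h2 : ∀ᵐ p : 𝔼 × 𝔼, (p.2 ∈ E ↔ p.2 ∈ F) := by
    rw [Measure.volume_eq_prod]
    exact Measure.quasiMeasurePreserving_snd.ae (h.mono fun x hx => iff_of_eq hx)
  refine measure_congr (interactionMeasure_absolutelyContinuous.ae_le ?_)
  filter_upwards [h1, h2] with p h1 h2
  refine propext ?_
  change (p ∈ crossRegion Ω ∧ p.1 ∈ E ∧ ¬ p.2 ∈ E) ↔ (p ∈ crossRegion Ω ∧ p.1 ∈ F ∧ ¬ p.2 ∈ F)
  rw [h1, h2]

/-- Submodularity of the fractional perimeter. -/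
lemma energy_union_add_inter_le {Ω E F : Set 𝔼} (hΩ : IsOpen Ω)
    (hE : NullMeasurableSet E volume) (hF : NullMeasurableSet F volume) :
    energy s Ω (E ∪ F) + energy s Ω (E ∩ F) ≤ energy s Ω E + energy s Ω F := by
  have hQ := (measurableSet_crossRegion hΩ).nullMeasurableSet (μ := interactionMeasure n s)
  unfold energy
  rw [← measure_union_add_inter₀ _
      (hQ.inter (nullMeasurableSet_prod (hE.inter hF) (hE.inter hF).compl)),
    ← measure_union_add_inter₀ _ (hQ.inter (nullMeasurableSet_prod hF hF.compl))]
  -- Pair by pair: the union of the two regions on the left lies in the union of those on the right,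
  -- and likewise for the intersections.
  refine add_le_add (measure_mono fun p hp => ?_) (measure_mono fun p hp => ?_) <;>
  · simp only [mem_union, mem_inter_iff, mem_prod, mem_compl_iff] at hp ⊢
    tauto

/-- Lower semicontinuity along increasing sequences: for the union E, the product E × Eᶜ is the
increasing union of the F_k × Eᶜ, each contained in F_k × F_kᶜ. -/
lemma energy_iUnion_le {Ω : Set 𝔼} {F : ℕ → Set 𝔼} (hF : Monotone F) {c : ℝ≥0∞}
    (h : ∀ k, energy s Ω (F k) ≤ c) : energy s Ω (⋃ k, F k) ≤ c := by
  have e : crossRegion Ω ∩ (⋃ k, F k) ×ˢ (⋃ k, F k)ᶜ =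
      ⋃ k, crossRegion Ω ∩ F k ×ˢ (⋃ k, F k)ᶜ := by
    rw [iUnion_prod_const, inter_iUnion]
  rw [energy, e, Monotone.measure_iUnion fun i j hij =>
    inter_subset_inter_right _ (prod_mono_left (hF hij))]
  refine iSup_le fun k => (measure_mono ?_).trans (h k)
  exact inter_subset_inter_right _
    (prod_mono_right (compl_subset_compl.2 (subset_iUnion F k)))

lemma energy_iInter_le {Ω : Set 𝔼} {F : ℕ → Set 𝔼} (hF : Antitone F) {c : ℝ≥0∞} {k₀ : ℕ}
    (h : ∀ k ≥ k₀, energy s Ω (F k) ≤ c) : energy s Ω (⋂ k, F k) ≤ c := by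
  have e : crossRegion Ω ∩ (⋂ k, F k) ×ˢ (⋂ k, F k)ᶜ =
      ⋃ k, crossRegion Ω ∩ (⋂ k, F k) ×ˢ (F k)ᶜ := by
    rw [compl_iInter, prod_iUnion, inter_iUnion]
  have hmono : Monotone fun k => crossRegion Ω ∩ (⋂ k, F k) ×ˢ (F k)ᶜ := fun i j hij =>
    inter_subset_inter_right _ (prod_mono_right (compl_subset_compl.2 (hF hij)))
  rw [energy, e, hmono.measure_iUnion]
  refine iSup_le fun k => (measure_mono (hmono (le_max_left k k₀))).trans
    ((measure_mono ?_).trans (h (max k k₀) (le_max_right _ _)))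
  exact inter_subset_inter_right _ (prod_mono_left (iInter_subset F _))

/-! ### Minimal and maximal sets: existence and comparison -/

lemma isSMinimalSet_iff {Ω E : Set 𝔼} (hΩ : IsOpen Ω) :
    IsSMinimalSet s Ω E ↔ NullMeasurableSet E volume ∧ energy s Ω E < ⊤ ∧
      ∀ F : Set 𝔼, NullMeasurableSet F volume → F \ Ω = E \ Ω →
        energy s Ω E ≤ energy s Ω F := by
  refine and_congr_right fun hE => ?_
  rw [fracPerimeter_eq_energy hΩ hE]
  refine and_congr_right fun _ => forall_congr' fun F => forall_congr' fun hF => ?_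
  rw [fracPerimeter_eq_energy hΩ hF]

lemma _root_.IsSMinimalSet.compl {Ω E : Set 𝔼} (hΩ : IsOpen Ω) (h : IsSMinimalSet s Ω E) :
    IsSMinimalSet s Ω Eᶜ := by
  rw [isSMinimalSet_iff hΩ] at h ⊢
  refine ⟨h.1.compl, energy_compl.trans_lt h.2.1, fun F hF hFE => ?_⟩
  rw [energy_compl, ← energy_compl (E := F)]
  refine h.2.2 _ hF.compl ?_
  ext x
  have := Set.ext_iff.1 hFE x
  simp only [Set.mem_sdiff, mem_compl_iff] at this ⊢
  tauto

lemma energy_diff_le {Ω E₀ : Set 𝔼} :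
    energy s Ω (E₀ \ Ω) ≤ interactionMeasure n s (Ω ×ˢ Ωᶜ) := by
  rw [interactionMeasure_prod_comm]
  refine measure_mono fun p hp => ?_
  simp only [crossRegion, mem_inter_iff, mem_compl_iff, mem_prod, Set.mem_sdiff] at hp ⊢
  tauto

/-- No compactness is needed. Intersections of admissible sets are admissible, hence have energy at
least the infimum m; by submodularity the excess over m is subadditive under unions. For a
minimizing sequence with excess at most 2^{-k}, the limsup of the sets is then a minimizer. -/
lemma exists_isSMinimalSetWrt {Ω E₀ : Set 𝔼} (hΩ : IsOpen Ω)
    (hE₀ : NullMeasurableSet (E₀ \ Ω) volume)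
    (hfin : interactionMeasure n s (Ω ×ˢ Ωᶜ) ≠ ⊤) :
    ∃ E, IsSMinimalSetWrt s Ω E₀ E := by
  set adm : Set (Set 𝔼) := {F | NullMeasurableSet F volume ∧ F \ Ω = E₀ \ Ω} with hadm
  set m : ℝ≥0∞ := sInf (energy s Ω '' adm) with hm
  have h₀ : E₀ \ Ω ∈ adm := ⟨hE₀, by rw [sdiff_sdiff, union_self]⟩
  have hmle : ∀ F ∈ adm, m ≤ energy s Ω F := fun F hF => sInf_le ⟨F, hF, rfl⟩
  have hmt : m ≠ ⊤ := ne_top_of_le_ne_top hfin ((hmle _ h₀).trans energy_diff_le)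
  have hu : ∀ A ∈ adm, ∀ B ∈ adm, A ∪ B ∈ adm := fun A hA B hB =>
    ⟨hA.1.union hB.1, by rw [union_sdiff_distrib, hA.2, hB.2, union_self]⟩
  have hi : ∀ A ∈ adm, ∀ B ∈ adm, A ∩ B ∈ adm := fun A hA B hB =>
    ⟨hA.1.inter hB.1, by rw [inter_sdiff, hA.2, hB.2, inter_self]⟩
  have hsub : ∀ A ∈ adm, ∀ B ∈ adm, ∀ a b : ℝ≥0∞, energy s Ω A ≤ m + a →
      energy s Ω B ≤ m + b → energy s Ω (A ∪ B) ≤ m + (a + b) := by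
    intro A hA B hB a b ha hb
    refine (ENNReal.add_le_add_iff_right hmt).1 ?_
    calc energy s Ω (A ∪ B) + m ≤ energy s Ω (A ∪ B) + energy s Ω (A ∩ B) := by
          gcongr; exact hmle _ (hi A hA B hB)
      _ ≤ energy s Ω A + energy s Ω B := energy_union_add_inter_le hΩ hA.1 hB.1
      _ ≤ (m + a) + (m + b) := add_le_add ha hb
      _ = m + (a + b) + m := by ring
  have hε0 : ∀ k : ℕ, ((2 : ℝ≥0∞)⁻¹) ^ k ≠ 0 := fun k => by simp
  have hex : ∀ k : ℕ, ∃ F ∈ adm, energy s Ω F ≤ m + (2⁻¹) ^ k := by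
    intro k
    obtain ⟨_, ⟨F, hF, rfl⟩, hlt⟩ := exists_lt_of_csInf_lt ⟨_, mem_image_of_mem _ h₀⟩
      (ENNReal.lt_add_right hmt (hε0 k))
    exact ⟨F, hF, hlt.le⟩
  choose E hE hEe using hex
  -- The bound is uniform in j because 2^{-k} + 2 · 2^{-(k+1)} = 2 · 2^{-k}.
  have hacc : ∀ j k : ℕ, (⋃ i ≤ j, E (k + i)) ∈ adm ∧
      energy s Ω (⋃ i ≤ j, E (k + i)) ≤ m + 2 * (2⁻¹) ^ k := by
    intro j
    induction j with
    | zero =>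
      intro k
      have : (⋃ i ≤ 0, E (k + i)) = E k := by simp
      rw [this]
      refine ⟨hE k, (hEe k).trans ?_⟩
      gcongr
      rw [two_mul]
      exact le_self_add
    | succ j ih =>
      intro k
      have : (⋃ i ≤ j + 1, E (k + i)) = E k ∪ ⋃ i ≤ j, E (k + 1 + i) := by
        ext x
        simp only [mem_iUnion, mem_union, exists_prop]
        constructor
        · rintro ⟨i, hi, hx⟩
          rcases i with _ | i
          · exact Or.inl hx
          · exact Or.inr ⟨i, by omega, by rwa [add_assoc, add_comm 1 i]⟩
        · rintro (hx | ⟨i, hi, hx⟩)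
          · exact ⟨0, by omega, hx⟩
          · exact ⟨i + 1, by omega, by rwa [add_assoc, add_comm 1 i] at hx⟩
      rw [this]
      refine ⟨hu _ (hE k) _ (ih (k + 1)).1,
        (hsub _ (hE k) _ (ih (k + 1)).1 _ _ (hEe k) (ih (k + 1)).2).trans_eq ?_⟩
      rw [pow_succ', ← mul_assoc, ENNReal.mul_inv_cancel two_ne_zero ENNReal.ofNat_ne_top, one_mul,
        ← two_mul]
  set G : ℕ → Set 𝔼 := fun k => ⋃ i, E (k + i) with hG
  have hGU : ∀ k, G k = ⋃ j, ⋃ i ≤ j, E (k + i) := fun k => biUnion_le_eq_iUnion.symm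
  have hGadm : ∀ k, G k ∈ adm := fun k =>
    ⟨NullMeasurableSet.iUnion fun i => (hE _).1, by
      simp only [hG, iUnion_sdiff, (hE _).2, iUnion_const]⟩
  have hGe : ∀ k, energy s Ω (G k) ≤ m + 2 * (2⁻¹) ^ k := by
    intro k
    rw [hGU]
    refine energy_iUnion_le (fun i j hij => ?_) fun j => (hacc j k).2
    exact biUnion_mono (fun l hl => le_trans (show l ≤ i from hl) hij) fun _ _ => subset_rfl
  have hGanti : Antitone G := antitone_nat_of_succ_le fun k => by
    refine iUnion_subset fun i => ?_
    rw [add_assoc]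
    exact subset_iUnion (fun i => E (k + i)) (1 + i)
  have hLadm : (⋂ k, G k) ∈ adm :=
    ⟨NullMeasurableSet.iInter fun k => (hGadm k).1, by
      rw [Set.sdiff_eq, iInter_inter]
      simp only [← Set.sdiff_eq, (hGadm _).2, iInter_const]⟩
  have hLe : energy s Ω (⋂ k, G k) ≤ m := by
    have hlim : Tendsto (fun k : ℕ => m + 2 * ((2 : ℝ≥0∞)⁻¹) ^ k) atTop (𝓝 (m + 2 * 0)) :=
      (ENNReal.Tendsto.const_mul (ENNReal.tendsto_pow_atTop_nhds_zero_of_lt_one (by norm_num))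
        (Or.inr ENNReal.ofNat_ne_top)).const_add m
    rw [mul_zero, add_zero] at hlim
    refine ge_of_tendsto' hlim fun k => energy_iInter_le hGanti (k₀ := k) fun j hj => ?_
    refine (hGe j).trans ?_
    refine add_le_add le_rfl (mul_le_mul_right ?_ 2)
    exact pow_le_pow_right_of_le_one' (ENNReal.inv_le_one.2 one_le_two) hj
  refine ⟨⋂ k, G k, (isSMinimalSet_iff hΩ).2 ⟨hLadm.1, hLe.trans_lt hmt.lt_top, fun F hF hFE =>
    hLe.trans (hmle F ⟨hF, hFE.trans hLadm.2⟩)⟩, hLadm.2⟩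

/-- The intersection carries the smaller datum D₂, so its energy is at least that of E₂;
submodularity leaves the union with no more energy than E₁. -/
lemma _root_.IsSMinimalSetWrt.union {Ω D₁ D₂ E₁ E₂ : Set 𝔼} (hΩ : IsOpen Ω)
    (h₁ : IsSMinimalSetWrt s Ω D₁ E₁) (h₂ : IsSMinimalSetWrt s Ω D₂ E₂) (hD : D₂ \ Ω ⊆ D₁ \ Ω) :
    IsSMinimalSetWrt s Ω D₁ (E₁ ∪ E₂) := by
  obtain ⟨hm₁, hd₁⟩ := h₁
  obtain ⟨hm₂, hd₂⟩ := h₂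
  rw [isSMinimalSet_iff hΩ] at hm₁ hm₂
  have hdiff : (E₁ ∪ E₂) \ Ω = E₁ \ Ω := by
    rw [union_sdiff_distrib, hd₁, hd₂, union_eq_left.2 hD]
  have hint : (E₁ ∩ E₂) \ Ω = E₂ \ Ω := by
    rw [inter_sdiff, hd₁, hd₂, inter_eq_right.2 hD]
  have hle : energy s Ω (E₁ ∪ E₂) ≤ energy s Ω E₁ := by
    refine (ENNReal.add_le_add_iff_right hm₂.2.1.ne).1 ?_
    refine le_trans ?_ (energy_union_add_inter_le hΩ hm₁.1 hm₂.1)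
    gcongr
    exact hm₂.2.2 _ (hm₁.1.inter hm₂.1) hint
  refine ⟨(isSMinimalSet_iff hΩ).2 ⟨hm₁.1.union hm₂.1, hle.trans_lt hm₁.2.1, fun F hF hFE => ?_⟩,
    hdiff.trans hd₁⟩
  exact hle.trans (hm₁.2.2 F hF (hFE.trans hdiff))

lemma _root_.IsSMinimalSetWrt.iUnion {Ω D : Set 𝔼} (hΩ : IsOpen Ω) {E : ℕ → Set 𝔼}
    (h : ∀ k, IsSMinimalSetWrt s Ω D (E k)) : IsSMinimalSetWrt s Ω D (⋃ k, E k) := by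
  have hacc : ∀ k, IsSMinimalSetWrt s Ω D (⋃ i ≤ k, E i) := by
    intro k
    induction k with
    | zero => simpa using h 0
    | succ k ih => rw [biUnion_le_succ]; exact ih.union hΩ (h (k + 1)) subset_rfl
  have hdiff : (⋃ k, E k) \ Ω = D \ Ω := by simp only [iUnion_sdiff, (h _).2, iUnion_const]
  have hmin := fun k => (isSMinimalSet_iff hΩ).1 (hacc k).1
  have h0 : energy s Ω (⋃ k, E k) ≤ energy s Ω (⋃ i ≤ 0, E i) := by
    rw [← biUnion_le_eq_iUnion]
    refine energy_iUnion_le (fun i j hij => ?_) fun k => ?_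
    · exact biUnion_mono (fun l hl => le_trans (show l ≤ i from hl) hij) fun _ _ => subset_rfl
    · exact (hmin k).2.2 _ (hmin 0).1 ((hacc 0).2.trans (hacc k).2.symm)
  refine ⟨(isSMinimalSet_iff hΩ).2 ⟨NullMeasurableSet.iUnion fun k => (h k).1.1,
    h0.trans_lt (hmin 0).2.1, fun F hF hFE => ?_⟩, hdiff⟩
  exact h0.trans ((hmin 0).2.2 F hF ((hFE.trans hdiff).trans (hacc 0).2.symm))

/-- The union of a sequence of minimal sets whose volumes in Ω approach the supremum is minimal and
attains it. -/
lemma exists_isMaximalSMinimalSet {Ω E₀ : Set 𝔼} (hΩ : IsOpen Ω)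
    (hE₀ : NullMeasurableSet (E₀ \ Ω) volume)
    (hfin : interactionMeasure n s (Ω ×ˢ Ωᶜ) ≠ ⊤) :
    ∃ E, IsMaximalSMinimalSet s Ω E₀ E := by
  obtain ⟨E, hE⟩ := exists_isSMinimalSetWrt hΩ hE₀ hfin
  obtain ⟨v, -, hv, hvmem⟩ := exists_seq_tendsto_sSup
    (S := (fun F => volume (F ∩ Ω)) '' {F | IsSMinimalSetWrt s Ω E₀ F})
    ⟨_, mem_image_of_mem _ hE⟩ (OrderTop.bddAbove _)
  choose G hG hGv using hvmem
  refine ⟨⋃ k, G k, _root_.IsSMinimalSetWrt.iUnion hΩ hG, fun F hF => ?_⟩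
  refine (le_sSup (mem_image_of_mem (fun F => volume (F ∩ Ω)) hF)).trans
    (le_of_tendsto' hv fun k => ?_)
  rw [← hGv k]
  exact measure_mono (inter_subset_inter_left _ (subset_iUnion G k))

/-- Comparison principle: E₁ ∪ E₂ is minimal for the larger datum, so by maximality of E₁ it cannot
have more volume in Ω. It gives both the nesting of the E_t and the uniqueness of maximal sets up to
null sets. -/
lemma _root_.IsMaximalSMinimalSet.measure_diff_eq_zero {Ω D₁ D₂ E₁ E₂ : Set 𝔼} (hΩ : IsOpen Ω)
    (hΩt : volume Ω ≠ ⊤) (h₁ : IsMaximalSMinimalSet s Ω D₁ E₁)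
    (h₂ : IsSMinimalSetWrt s Ω D₂ E₂) (hD : D₂ \ Ω ⊆ D₁ \ Ω) : volume (E₂ \ E₁) = 0 := by
  have hle := h₁.2 _ (h₁.1.union hΩ h₂ hD)
  have hout : E₂ \ Ω ⊆ E₁ \ Ω := by rw [h₁.1.2, h₂.2]; exact hD
  have e : E₂ \ E₁ = ((E₁ ∪ E₂) ∩ Ω) \ (E₁ ∩ Ω) := by
    ext x
    have := @hout x
    simp only [Set.mem_sdiff, mem_inter_iff, mem_union] at this ⊢
    tauto
  have hnm : NullMeasurableSet (E₁ ∩ Ω) volume :=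
    h₁.1.1.1.inter hΩ.measurableSet.nullMeasurableSet
  have ht : volume (E₁ ∩ Ω) ≠ ⊤ := ne_top_of_le_ne_top hΩt (measure_mono inter_subset_right)
  rw [e, measure_sdiff (inter_subset_inter_left _ subset_union_left) hnm ht]
  exact tsub_eq_zero_of_le hle

/-! ### Cutting a piece off a minimal set; the influence of distant data -/

/-- E \ A is a competitor. The interaction of E \ A with Eᶜ over Q(Ω) is finite and common to both
energies, so it cancels. -/
lemma _root_.IsSMinimalSet.interaction_le {Ω E A : Set 𝔼} (hΩ : IsOpen Ω) (h : IsSMinimalSet s Ω E)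
    (hA : NullMeasurableSet A volume) (hAE : A ⊆ E) (hAΩ : A ⊆ Ω) :
    interactionMeasure n s (A ×ˢ Eᶜ) ≤ interactionMeasure n s (A ×ˢ (E \ A)) := by
  rw [isSMinimalSet_iff hΩ] at h
  obtain ⟨hE, hfin, hmin⟩ := h
  have hQ := (measurableSet_crossRegion hΩ).nullMeasurableSet (μ := interactionMeasure n s)
  have hle := hmin (E \ A) (hE.diff hA) (by rw [sdiff_sdiff, union_eq_right.2 hAΩ])
  have hcross : ∀ B : Set 𝔼, A ×ˢ B ⊆ crossRegion Ω := fun B p hp hp' => hp'.1 (hAΩ hp.1)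
  set c := interactionMeasure n s (crossRegion Ω ∩ (E \ A) ×ˢ Eᶜ) with hc
  have h1 : energy s Ω E = c + interactionMeasure n s (A ×ˢ Eᶜ) := by
    rw [hc, ← measure_union₀ (nullMeasurableSet_prod hA hE.compl)]
    · rw [energy]
      congr 1
      ext p
      have h1 := @hcross Eᶜ p
      have h2 := @hAE p.1
      simp only [mem_inter_iff, mem_union, mem_prod, Set.mem_sdiff, mem_compl_iff] at h1 h2 ⊢
      tauto
    · exact Disjoint.aedisjoint (disjoint_left.2 fun p hp hp' => hp.2.1.2 hp'.1)
  have h2 : energy s Ω (E \ A) ≤ c + interactionMeasure n s (A ×ˢ (E \ A)) := by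
    rw [interactionMeasure_prod_comm, hc]
    refine (measure_mono ?_).trans (measure_union_le _ _)
    intro p hp
    simp only [mem_inter_iff, mem_union, mem_prod, Set.mem_sdiff, mem_compl_iff] at hp ⊢
    tauto
  have hcfin : c ≠ ⊤ := ne_top_of_le_ne_top hfin.ne (h1 ▸ le_self_add)
  exact (ENNReal.add_le_add_iff_left hcfin).1 (h1 ▸ hle.trans h2)

lemma _root_.IsSMinimalSet.interaction_compl_le {Ω E A : Set 𝔼} (hΩ : IsOpen Ω)
    (h : IsSMinimalSet s Ω E) (hA : NullMeasurableSet A volume) (hAE : A ⊆ E) (hAΩ : A ⊆ Ω) :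
    interactionMeasure n s (A ×ˢ Aᶜ) ≤ 2 * interactionMeasure n s (A ×ˢ (E \ A)) := by
  have e : A ×ˢ Aᶜ = A ×ˢ Eᶜ ∪ A ×ˢ (E \ A) := by
    rw [← prod_union]
    congr 1
    ext x
    have := @hAE x
    simp only [mem_union, Set.mem_sdiff, mem_compl_iff]
    tauto
  rw [e, two_mul]
  exact (measure_union_le _ _).trans (add_le_add_left (h.interaction_le hΩ hA hAE hAΩ) _)

/-- If the exterior datum is at distance at least `Θ diam Ω` from `Ω`, then an `s`-minimal set has
no mass in `Ω`. -/
lemma _root_.IsSMinimalSet.measure_inter_eq_zero (hn : 1 ≤ n) (hs₀ : 0 < s) {Ω E : Set 𝔼}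
    (hΩ : IsOpen Ω) (hb : Bornology.IsBounded Ω) (h : IsSMinimalSet s Ω E) {Θ : ℝ}
    (hΘ : 2 * (4 : ℝ) ^ (1 / s) ≤ Θ)
    (hE : volume (E ∩ (thickening (Θ * diam Ω) Ω \ Ω)) = 0) : volume (E ∩ Ω) = 0 := by
  by_contra hne
  have hA : NullMeasurableSet (E ∩ Ω) volume := h.1.inter hΩ.measurableSet.nullMeasurableSet
  have hΩne : Ω.Nonempty := by
    by_contra h0
    rw [not_nonempty_iff_eq_empty.1 h0] at hne
    simp at hne
  have hAt : volume (E ∩ Ω) ≠ ⊤ :=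
    ne_top_of_le_ne_top hb.measure_lt_top.ne (measure_mono inter_subset_right)
  set d := diam Ω with hd
  have hd0 : 0 < d := by
    have : Nonempty (Fin n) := ⟨⟨0, hn⟩⟩
    refine (diam_pos ?_ hb)
    rw [← not_subsingleton_iff]
    intro hsub
    refine (hΩ.measure_pos volume hΩne).ne' ?_
    exact hsub.measure_zero volume
  -- With T the kernel tail at 2d, each point of A = E ∩ Ω interacts with Aᶜ by at least T, as A has
  -- diameter at most d. Pushing E \ A out by the factor 4^{1/s} reduces its interaction to at most
  -- T/4. The cutting inequality then reads |A| T ≤ 2 |A| T/4, which forces |A| = 0.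
  have hΘd : 2 * d * (4 : ℝ) ^ (1 / s) ≤ Θ * d := by nlinarith
  have hfar : ∀ x ∈ E ∩ Ω, ∫⁻ y in E \ (E ∩ Ω), fracKernel n s (x - y) ≤
      kernelTail n s (2 * d * 4 ^ (1 / s)) := by
    intro x hx
    refine lintegral_fracKernel_le_tail ?_
    have : ∀ᵐ y, y ∉ E ∩ (thickening (Θ * d) Ω \ Ω) := measure_eq_zero_iff_ae_notMem.1 hE
    filter_upwards [this] with y hy hyE
    have hy2 : y ∉ thickening (Θ * d) Ω := fun hy' =>
      hy ⟨hyE.1, hy', fun hyΩ => hyE.2 ⟨hyE.1, hyΩ⟩⟩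
    refine hΘd.trans ?_
    by_contra! hlt
    refine hy2 (mem_thickening_iff.2 ⟨x, hx.2, ?_⟩)
    rwa [dist_comm, dist_eq_norm]
  have hnear : ∀ x ∈ E ∩ Ω, kernelTail n s (2 * d) ≤
      ∫⁻ y in (E ∩ Ω)ᶜ, fracKernel n s (x - y) := by
    intro x hx
    rw [← lintegral_fracKernel_far x]
    refine lintegral_mono_set fun y hy hyA => ?_
    have h1 := dist_le_diam_of_mem hb hx.2 hyA.2
    rw [dist_eq_norm] at h1
    have h2 : 2 * d ≤ ‖x - y‖ := hy
    linarith
  have hT : kernelTail n s (2 * d * 4 ^ (1 / s)) = 4⁻¹ * kernelTail n s (2 * d) := by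
    rw [kernelTail_eq (by positivity), kernelTail_eq (by positivity : 0 < 2 * d),
      Real.mul_rpow (by positivity) (by positivity), ← Real.rpow_mul (by norm_num), ← mul_assoc,
      mul_comm ((2 * d) ^ (-s)), ENNReal.ofReal_mul (by positivity)]
    congr 2
    rw [show 1 / s * -s = -1 by field_simp, Real.rpow_neg_one,
      ENNReal.ofReal_inv_of_pos (by norm_num)]
    norm_num
  have hTt := kernelTail_ne_top (n := n) hs₀ (by positivity : 0 < 2 * d)
  have hT0 : kernelTail n s (2 * d) ≠ 0 := by
    rw [kernelTail_eq (by positivity)]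
    exact mul_ne_zero (ENNReal.ofReal_pos.2 (by positivity)).ne' (kernelTail_one_ne_zero hn)
  set T := kernelTail n s (2 * d) with hTdef
  have hmain := h.interaction_compl_le hΩ hA inter_subset_left inter_subset_right
  rw [interactionMeasure_prod, interactionMeasure_prod] at hmain
  have h1 : volume (E ∩ Ω) * T ≤ 2 * (volume (E ∩ Ω) * (4⁻¹ * T)) := by
    calc volume (E ∩ Ω) * T = ∫⁻ _ in E ∩ Ω, T := by rw [setLIntegral_const, mul_comm]
      _ ≤ ∫⁻ x in E ∩ Ω, ∫⁻ y in (E ∩ Ω)ᶜ, fracKernel n s (x - y) := by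
        refine lintegral_mono_ae ?_
        filter_upwards [ae_restrict_mem₀ hA] with x hx using hnear x hx
      _ ≤ _ := hmain
      _ ≤ 2 * ∫⁻ _ in E ∩ Ω, 4⁻¹ * T := by
        gcongr 2 * ?_
        refine lintegral_mono_ae ?_
        filter_upwards [ae_restrict_mem₀ hA] with x hx using hT ▸ hfar x hx
      _ = _ := by rw [setLIntegral_const, mul_comm (4⁻¹ * T)]
  have hVT0 : volume (E ∩ Ω) * T ≠ 0 := mul_ne_zero hne hT0
  have hVTt : volume (E ∩ Ω) * T ≠ ⊤ := ENNReal.mul_ne_top hAt hTt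
  have h2 : volume (E ∩ Ω) * T ≤ 2⁻¹ * (volume (E ∩ Ω) * T) := by
    refine h1.trans_eq ?_
    have : (2 : ℝ≥0∞) * 4⁻¹ = 2⁻¹ := by
      rw [show (4 : ℝ≥0∞) = 2 * 2 by norm_num,
        ENNReal.mul_inv (Or.inl two_ne_zero) (Or.inl ENNReal.ofNat_ne_top), ← mul_assoc,
        ENNReal.mul_inv_cancel two_ne_zero ENNReal.ofNat_ne_top, one_mul]
    rw [← this]
    ring
  refine absurd h2 (not_le.2 ?_)
  rw [mul_comm, ← div_eq_mul_inv]
  exact ENNReal.half_lt_self hVT0 hVTt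

/-! ### The density estimate -/

lemma lintegral_rpow_sub (hs : s < 1) {b t : ℝ} (hbt : b ≤ t) :
    ∫⁻ r in Ioo b t, ENNReal.ofReal ((r - b) ^ (-s)) =
      ENNReal.ofReal ((t - b) ^ (1 - s) / (1 - s)) := by
  have hI : IntervalIntegrable (fun r : ℝ => (r - b) ^ (-s)) volume b t := by
    have := (intervalIntegral.intervalIntegrable_rpow' (a := 0) (b := t - b)
      (show -1 < -s by linarith)).comp_sub_right b
    simpa using this
  have hnn : 0 ≤ᵐ[volume.restrict (Ioc b t)] fun r : ℝ => (r - b) ^ (-s) := by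
    filter_upwards [ae_restrict_mem measurableSet_Ioc] with r hr
    exact Real.rpow_nonneg (by linarith [hr.1]) _
  rw [setLIntegral_congr Ioo_ae_eq_Ioc, ← ofReal_integral_eq_lintegral_ofReal hI.1 hnn,
    ← intervalIntegral.integral_of_le hbt,
    intervalIntegral.integral_comp_sub_right (fun r : ℝ => r ^ (-s)), sub_self,
    integral_rpow (Or.inl (by linarith)), Real.zero_rpow (by linarith), sub_zero,
    show -s + 1 = 1 - s by ring]

/-- Moving the singularity a up to max a ρ only increases the integrand, so the bound is uniform in
a. -/
lemma lintegral_indicator_rpow_sub_le (hs₀ : 0 < s) (hs : s < 1) (ρ t : ℝ) (a : ℝ) :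
    ∫⁻ r in Ioo ρ t, (Ioi a).indicator (fun r => ENNReal.ofReal ((r - a) ^ (-s))) r ≤
      ENNReal.ofReal ((t - ρ) ^ (1 - s) / (1 - s)) := by
  rw [setLIntegral_indicator measurableSet_Ioi]
  have hsub : Ioi a ∩ Ioo ρ t = Ioo (max a ρ) t := by
    ext r
    simp only [mem_inter_iff, mem_Ioi, mem_Ioo, max_lt_iff]
    tauto
  rw [hsub]
  rcases le_or_gt t (max a ρ) with h | h
  · rw [Ioo_eq_empty (not_lt.2 h)]
    simp
  · calc ∫⁻ r in Ioo (max a ρ) t, ENNReal.ofReal ((r - a) ^ (-s))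
        ≤ ∫⁻ r in Ioo (max a ρ) t, ENNReal.ofReal ((r - max a ρ) ^ (-s)) := by
          refine setLIntegral_mono' measurableSet_Ioo fun r hr => ENNReal.ofReal_le_ofReal ?_
          exact Real.rpow_le_rpow_of_nonpos (by linarith [hr.1])
            (by linarith [le_max_left a ρ]) (by linarith)
      _ = _ := lintegral_rpow_sub hs h.le
      _ ≤ _ := by
          refine ENNReal.ofReal_le_ofReal (div_le_div_of_nonneg_right ?_ (by linarith))
          exact Real.rpow_le_rpow (by linarith) (by linarith [le_max_right a ρ]) (by linarith)

/-- Growth of the volume of an `s`-minimal set in concentric balls. -/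
lemma exists_volume_growth (hn : 1 ≤ n) (hs₀ : 0 < s) (hs₁ : s < 1) :
    ∃ C : ℝ, 0 < C ∧ ∀ Ω E : Set 𝔼, IsOpen Ω → IsSMinimalSet s Ω E → ∀ (z : 𝔼) (ρ t : ℝ),
      0 < ρ → ρ < t → ball z t ⊆ Ω →
      (volume (E ∩ ball z ρ)).toReal ^ (1 - s / n) ≤
        C * (t - ρ) ^ (-s) * (volume (E ∩ ball z t)).toReal := by
  obtain ⟨c, hc, hiso⟩ := exists_isoperimetric hn hs₀ hs₁
  have hsn : 0 ≤ 1 - s / n := by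
    have hn' : (1 : ℝ) ≤ n := by exact_mod_cast hn
    rw [sub_nonneg, div_le_one (by linarith)]
    linarith
  set T := (kernelTail n s 1).toReal with hT
  have hTe : kernelTail n s 1 = ENNReal.ofReal T :=
    (ENNReal.ofReal_toReal (kernelTail_one_ne_top hs₀)).symm
  have hT0 : 0 < T := ENNReal.toReal_pos (kernelTail_one_ne_zero hn) (kernelTail_one_ne_top hs₀)
  have h1s : 0 < 1 - s := by linarith
  refine ⟨2 * T / (1 - s) / c, by positivity, fun Ω E hΩ hE z ρ t hρ hρt hball => ?_⟩
  have hA : ∀ r, NullMeasurableSet (E ∩ ball z r) volume := fun r =>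
    hE.1.inter measurableSet_ball.nullMeasurableSet
  have hAt : ∀ r, volume (E ∩ ball z r) ≠ ⊤ := fun r =>
    ne_top_of_le_ne_top measure_ball_lt_top.ne (measure_mono inter_subset_right)
  -- Up to the constant T, g r y is the kernel tail at distance r - |y - z|, which bounds the
  -- interaction of y with E outside the ball of radius r. It is not controlled for a single r, but
  -- since s < 1 its singularity disappears on integrating over r in (ρ, t).
  set g : ℝ → 𝔼 → ℝ≥0∞ := fun r y =>
    (Ioi (dist y z)).indicator (fun r => ENNReal.ofReal ((r - dist y z) ^ (-s))) r with hg
  have hgm : Measurable (Function.uncurry g) := by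
    have : Function.uncurry g = {p : ℝ × 𝔼 | dist p.2 z < p.1}.indicator
        (fun p => ENNReal.ofReal ((p.1 - dist p.2 z) ^ (-s))) := by
      ext p
      simp [Function.uncurry, hg, indicator]
    rw [this]
    exact Measurable.indicator (by fun_prop) (measurableSet_lt (by fun_prop) (by fun_prop))
  have hr : ∀ r ∈ Ioo ρ t, ENNReal.ofReal (c * (volume (E ∩ ball z ρ)).toReal ^ (1 - s / n)) ≤
      2 * ENNReal.ofReal T * ∫⁻ y in E ∩ ball z t, g r y := by
    intro r hr
    have hsubΩ : E ∩ ball z r ⊆ Ω :=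
      inter_subset_right.trans ((ball_subset_ball hr.2.le).trans hball)
    calc ENNReal.ofReal (c * (volume (E ∩ ball z ρ)).toReal ^ (1 - s / n))
        ≤ ENNReal.ofReal (c * (volume (E ∩ ball z r)).toReal ^ (1 - s / n)) := by
          refine ENNReal.ofReal_le_ofReal (mul_le_mul_of_nonneg_left ?_ hc.le)
          refine Real.rpow_le_rpow ENNReal.toReal_nonneg (ENNReal.toReal_mono (hAt r) ?_) hsn
          exact measure_mono (inter_subset_inter_right _ (ball_subset_ball hr.1.le))
      _ ≤ _ := hiso _ (hA r) (hAt r)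
      _ ≤ _ := hE.interaction_compl_le hΩ (hA r) inter_subset_left hsubΩ
      _ ≤ 2 * (ENNReal.ofReal T * ∫⁻ y in E ∩ ball z t, g r y) := by
          gcongr 2 * ?_
          rw [interactionMeasure_prod, ← lintegral_const_mul' _ _ ENNReal.ofReal_ne_top]
          refine le_trans (lintegral_mono_ae ?_) (lintegral_mono_set
            (inter_subset_inter_right _ (ball_subset_ball hr.2.le)))
          filter_upwards [ae_restrict_mem₀ (hA r)] with y hy
          have hyr : dist y z < r := hy.2
          have : g r y = ENNReal.ofReal ((r - dist y z) ^ (-s)) := by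
            simp only [hg]; rw [indicator_of_mem (by exact hyr)]
          rw [this, ← hTe, mul_comm, ← kernelTail_eq (sub_pos.2 hyr)]
          refine lintegral_fracKernel_le_tail (Eventually.of_forall fun w hw => ?_)
          have hw' : r ≤ dist w z := by
            by_contra! h
            exact hw.2 ⟨hw.1, h⟩
          have := dist_triangle w y z
          rw [← dist_eq_norm, dist_comm y w]
          linarith
      _ = _ := by rw [mul_assoc]
  have hint : ENNReal.ofReal (t - ρ) *
      ENNReal.ofReal (c * (volume (E ∩ ball z ρ)).toReal ^ (1 - s / n)) ≤
      2 * ENNReal.ofReal T * (ENNReal.ofReal ((t - ρ) ^ (1 - s) / (1 - s)) *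
        volume (E ∩ ball z t)) := by
    calc _ = ∫⁻ _ in Ioo ρ t,
          ENNReal.ofReal (c * (volume (E ∩ ball z ρ)).toReal ^ (1 - s / n)) := by
          rw [setLIntegral_const, Real.volume_Ioo, mul_comm]
      _ ≤ ∫⁻ r in Ioo ρ t, 2 * ENNReal.ofReal T * ∫⁻ y in E ∩ ball z t, g r y :=
          setLIntegral_mono' measurableSet_Ioo hr
      _ = 2 * ENNReal.ofReal T * ∫⁻ y in E ∩ ball z t, ∫⁻ r in Ioo ρ t, g r y := by
          rw [lintegral_const_mul' _ _ (ENNReal.mul_ne_top ENNReal.ofNat_ne_top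
            ENNReal.ofReal_ne_top), lintegral_lintegral_swap hgm.aemeasurable]
      _ ≤ 2 * ENNReal.ofReal T *
          ∫⁻ _ in E ∩ ball z t, ENNReal.ofReal ((t - ρ) ^ (1 - s) / (1 - s)) := by
          gcongr with y
          exact lintegral_indicator_rpow_sub_le hs₀ hs₁ _ _ _
      _ = _ := by rw [setLIntegral_const]
  have htρ : 0 < t - ρ := sub_pos.2 hρt
  have h2T : (2 : ℝ≥0∞) * ENNReal.ofReal T = ENNReal.ofReal (2 * T) := by
    rw [ENNReal.ofReal_mul zero_le_two, ENNReal.ofReal_ofNat]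
  rw [← ENNReal.ofReal_toReal (hAt t), h2T, ← ENNReal.ofReal_mul htρ.le,
    ← ENNReal.ofReal_mul (by positivity),
    ← ENNReal.ofReal_mul (by positivity),
    ENNReal.ofReal_le_ofReal_iff (by positivity)] at hint
  rw [show 1 - s = -s + 1 by ring, Real.rpow_add_one htρ.ne', ← show 1 - s = -s + 1 by ring] at hint
  set v := (volume (E ∩ ball z ρ)).toReal ^ (1 - s / n)
  set V := (volume (E ∩ ball z t)).toReal
  have h2 : (t - ρ) * (c * v) ≤ (t - ρ) * (c * (2 * T / (1 - s) / c * (t - ρ) ^ (-s) * V)) := by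
    refine hint.trans_eq ?_
    field_simp
  exact le_of_mul_le_mul_left (le_of_mul_le_mul_left h2 htρ) hc

/-- De Giorgi iteration on radii decreasing from R to R/2. The gain in the exponent, 1 - s/n < 1,
beats the factors (t - ρ)^{-s}, and the smallness constant is the one for which the bound ε R^n
2^{-nk} reproduces itself exactly. -/
lemma eq_zero_of_volume_growth (hn : 1 ≤ n) (hs₀ : 0 < s) (hs₁ : s < 1) {C R : ℝ} (hC : 0 < C)
    (hR : 0 < R) {v : ℝ → ℝ} (hv0 : ∀ r, 0 ≤ v r) (hmono : Monotone v)
    (hv : ∀ ρ t, 0 < ρ → ρ < t → t ≤ R → v ρ ^ (1 - s / n) ≤ C * (t - ρ) ^ (-s) * v t)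
    (hsmall : v R ≤ (C * 2 ^ (s + n)) ^ (-(n / s)) * R ^ n) : v (R / 2) = 0 := by
  have hn' : (1 : ℝ) ≤ n := by exact_mod_cast hn
  have hsn : 0 < 1 - s / n := by
    rw [sub_pos, div_lt_one (by linarith)]
    linarith
  set ε := (C * 2 ^ (s + n)) ^ (-((n : ℝ) / s)) with hε
  have hε0 : 0 < ε := by positivity
  set r : ℕ → ℝ := fun k => R / 2 * (1 + (1 / 2) ^ k) with hr
  have key : ∀ k, v (r k) ≤ ε * R ^ n * ((1 / 2) ^ n) ^ k := by
    intro k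
    induction k with
    | zero =>
      have : r 0 = R := by simp only [hr, pow_zero]; ring
      rwa [this, pow_zero, mul_one]
    | succ k ih =>
      have hlt : r (k + 1) < r k := by
        simp only [hr, pow_succ]
        have : (0 : ℝ) < (1 / 2) ^ k := by positivity
        nlinarith
      have hle : r k ≤ R := by
        simp only [hr]
        have : ((1 : ℝ) / 2) ^ k ≤ 1 := pow_le_one₀ (by norm_num) (by norm_num)
        nlinarith
      have h1 := hv (r (k + 1)) (r k) (by positivity) hlt hle
      have hd : r k - r (k + 1) = R * (1 / 2) ^ (k + 2) := by
        simp only [hr, pow_succ]; ring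
      set M := ε * R ^ n * ((1 / 2) ^ n) ^ (k + 1) with hM
      have hM0 : 0 < M := by positivity
      rw [← Real.rpow_le_rpow_iff (hv0 _) hM0.le hsn]
      refine h1.trans ?_
      have hMn : M ^ (-(s / n)) = C * 2 ^ (s + n) * (R * (1 / 2) ^ (k + 1)) ^ (-s) := by
        have e1 : M = ε * (R * (1 / 2) ^ (k + 1)) ^ n := by
          rw [hM, mul_pow]; ring
        rw [e1, Real.mul_rpow (by positivity) (by positivity), hε, ← Real.rpow_mul (by positivity),
          ← Real.rpow_natCast (R * (1 / 2) ^ (k + 1)) n, ← Real.rpow_mul (by positivity)]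
        congr 1
        · rw [show -((n : ℝ) / s) * -(s / n) = 1 by field_simp, Real.rpow_one]
        · congr 1
          field_simp
      have hMθ : M ^ (1 - s / n) = M * M ^ (-(s / n)) := by
        rw [sub_eq_add_neg, Real.rpow_add hM0, Real.rpow_one]
      rw [hMθ, hMn, hd]
      have e2 : (R * (1 / 2) ^ (k + 2) : ℝ) ^ (-s) = (R * (1 / 2) ^ (k + 1)) ^ (-s) * 2 ^ s := by
        rw [pow_succ _ (k + 1), ← mul_assoc, Real.mul_rpow (by positivity) (by positivity)]
        congr 1
        rw [one_div, Real.inv_rpow (by norm_num), Real.rpow_neg (by norm_num), inv_inv]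
      have e3 : ε * R ^ n * ((1 / 2) ^ n) ^ k = M * 2 ^ n := by
        rw [hM, pow_succ, one_div, inv_pow]
        field_simp
      rw [e2]
      calc C * ((R * (1 / 2) ^ (k + 1)) ^ (-s) * 2 ^ s) * v (r k)
          ≤ C * ((R * (1 / 2) ^ (k + 1)) ^ (-s) * 2 ^ s) * (M * 2 ^ n) := by
            rw [← e3]; gcongr
        _ = _ := by
            rw [Real.rpow_add (by norm_num), Real.rpow_natCast]; ring
  refine le_antisymm ?_ (hv0 _)
  have hlim : Tendsto (fun k : ℕ => ε * R ^ n * (((1 : ℝ) / 2) ^ n) ^ k) atTop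
      (𝓝 (ε * R ^ n * 0)) := by
    refine (tendsto_pow_atTop_nhds_zero_of_lt_one (by positivity) ?_).const_mul _
    exact pow_lt_one₀ (by norm_num) (by norm_num) (by omega)
  rw [mul_zero] at hlim
  refine ge_of_tendsto' hlim fun k => (hmono ?_).trans (key k)
  simp only [hr]
  have : (0 : ℝ) < (1 / 2) ^ k := by positivity
  nlinarith

/-- The uniform density estimate for `s`-minimal sets. -/
lemma exists_density_estimate (hn : 1 ≤ n) (hs₀ : 0 < s) (hs₁ : s < 1) :
    ∃ ε : ℝ, 0 < ε ∧ ∀ Ω E : Set 𝔼, IsOpen Ω → IsSMinimalSet s Ω E → ∀ (z : 𝔼) (R : ℝ),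
      0 < R → ball z R ⊆ Ω → z ∈ measureClosure E →
      ENNReal.ofReal (ε * R ^ n) ≤ volume (E ∩ ball z R) := by
  obtain ⟨C, hC, hgrow⟩ := exists_volume_growth hn hs₀ hs₁
  refine ⟨(C * 2 ^ (s + n)) ^ (-((n : ℝ) / s)), by positivity,
    fun Ω E hΩ hE z R hR hball hz => ?_⟩
  by_contra! hlt
  have hAt : ∀ r, volume (E ∩ ball z r) ≠ ⊤ := fun r =>
    ne_top_of_le_ne_top measure_ball_lt_top.ne (measure_mono inter_subset_right)
  have h0 := eq_zero_of_volume_growth hn hs₀ hs₁ hC hR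
    (v := fun r => (volume (E ∩ ball z r)).toReal) (fun r => ENNReal.toReal_nonneg)
    (fun a b hab => ENNReal.toReal_mono (hAt b)
      (measure_mono (inter_subset_inter_right _ (ball_subset_ball hab))))
    (fun ρ t hρ hρt htR => hgrow Ω E hΩ hE z ρ t hρ hρt ((ball_subset_ball htR).trans hball))
    (ENNReal.toReal_le_of_le_ofReal (by positivity) hlt.le)
  rcases (ENNReal.toReal_eq_zero_iff _).1 h0 with h | h
  · exact (hz (R / 2) (by linarith)).ne' h
  · exact hAt _ h

/-! ### The measure-theoretic closure -/

lemma measureClosure_congr_of_inter {Ω E F : Set 𝔼} (hΩ : IsOpen Ω)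
    (h : volume ((E \ F) ∩ Ω) = 0) {x : 𝔼} (hx : x ∈ Ω) (hxE : x ∈ measureClosure E) :
    x ∈ measureClosure F := by
  intro r hr
  obtain ⟨δ, hδ, hball⟩ := Metric.isOpen_iff.1 hΩ x hx
  refine (hxE (min r δ) (lt_min hr hδ)).trans_le ?_
  calc volume (E ∩ ball x (min r δ)) ≤ volume (F ∩ ball x r ∪ (E \ F) ∩ Ω) := by
        refine measure_mono fun y hy => ?_
        have h1 := hball (ball_subset_ball (min_le_right r δ) hy.2)
        have h2 := ball_subset_ball (min_le_left r δ) hy.2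
        by_cases hyF : y ∈ F
        · exact Or.inl ⟨hyF, h2⟩
        · exact Or.inr ⟨⟨hy.1, hyF⟩, h1⟩
    _ ≤ volume (F ∩ ball x r) + volume ((E \ F) ∩ Ω) := measure_union_le _ _
    _ = _ := by rw [h, add_zero]

lemma isClosed_measureClosure (E : Set 𝔼) : IsClosed (measureClosure E) := by
  refine isClosed_of_closure_subset fun x hx r hr => ?_
  obtain ⟨y, hy, hxy⟩ := Metric.mem_closure_iff.1 hx (r / 2) (by linarith)
  refine (hy (r / 2) (by linarith)).trans_le (measure_mono (inter_subset_inter_right _ ?_))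
  exact ball_subset_ball' (by rw [dist_comm]; linarith)

/-- An `s`-minimal set agrees with its measure-theoretic closure almost everywhere in `Ω`. -/
lemma _root_.IsSMinimalSet.ae_mem_measureClosure_iff (hn : 1 ≤ n) (hs₀ : 0 < s) (hs₁ : s < 1)
    {Ω E : Set 𝔼} (hΩ : IsOpen Ω) (hE : IsSMinimalSet s Ω E) :
    ∀ᵐ x, x ∈ Ω → (x ∈ measureClosure E ↔ x ∈ E) := by
  obtain ⟨ε, hε, hdens⟩ := exists_density_estimate hn hs₀ hs₁
  obtain ⟨E', -, hE', hEE'⟩ := hE.1.exists_measurable_superset_ae_eq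
  filter_upwards [Besicovitch.ae_tendsto_measure_inter_div_of_measurableSet volume hE', hEE']
    with x hx hxE hxΩ
  have hxE : x ∈ E' ↔ x ∈ E := iff_of_eq hxE
  have hvol : ∀ B : Set 𝔼, volume (E' ∩ B) = volume (E ∩ B) := fun B =>
    measure_congr (hEE'.inter (ae_eq_refl B))
  rw [← hxE]
  by_cases hxm : x ∈ E'
  · refine iff_of_true (fun r hr => ?_) hxm
    rw [indicator_of_mem hxm, Pi.one_apply] at hx
    have h1 := (hx.eventually (lt_mem_nhds one_pos)).and (Ioo_mem_nhdsGT hr)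
    obtain ⟨ρ, h2, hρ⟩ := h1.exists
    rw [hvol] at h2
    refine (pos_iff_ne_zero.2 fun h0 => ?_ : 0 < volume (E ∩ closedBall x ρ)).trans_le
      (measure_mono (inter_subset_inter_right _ (closedBall_subset_ball hρ.2)))
    rw [h0] at h2
    simp at h2
  -- At a point of zero density of E, the density estimate excludes membership in the closure.
  · refine iff_of_false (fun hcl => ?_) hxm
    rw [indicator_of_notMem hxm] at hx
    obtain ⟨δ, hδ, hball⟩ := Metric.isOpen_iff.1 hΩ x hxΩ
    set ω := volume (ball (0 : 𝔼) 1) with hω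
    have hω0 : ω ≠ 0 := (measure_ball_pos _ _ one_pos).ne'
    have hωt : ω ≠ ⊤ := measure_ball_lt_top.ne
    have hpos : 0 < ENNReal.ofReal ε / ω := ENNReal.div_pos (ENNReal.ofReal_pos.2 hε).ne' hωt
    obtain ⟨ρ, h2, hρ⟩ := ((hx.eventually (gt_mem_nhds hpos)).and (Ioo_mem_nhdsGT hδ)).exists
    refine absurd h2 (not_lt.2 ?_)
    have hρ0 : 0 < ρ := hρ.1
    rw [hvol, Measure.addHaar_closedBall volume x hρ0.le, finrank_euclideanSpace_fin, ← hω,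
      ENNReal.le_div_iff_mul_le
        (Or.inl (mul_ne_zero (ENNReal.ofReal_pos.2 (by positivity)).ne' hω0))
        (Or.inl (ENNReal.mul_ne_top ENNReal.ofReal_ne_top hωt)), mul_comm (ENNReal.ofReal (ρ ^ n)),
      ← mul_assoc, ENNReal.div_mul_cancel hω0 hωt, ← ENNReal.ofReal_mul hε.le]
    refine (hdens Ω E hΩ hE x ρ hρ0 ((ball_subset_ball hρ.2.le).trans hball) hcl).trans ?_
    exact measure_mono (inter_subset_inter_right _ ball_subset_closedBall)

/-! ### Dyadic sums for the Hardy inequality -/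

/-- Summing the recursion gives 2A ≤ 2a₀ + cA + Σd for each partial sum A. As A is finite and c < 2,
the term cA can be absorbed. -/
lemma tsum_ne_top_of_two_mul_le {a d : ℕ → ℝ≥0∞} {c : ℝ≥0∞} (hc : c < 2)
    (ha : ∀ k, a k ≠ ⊤) (hd : ∑' k, d k ≠ ⊤) (h : ∀ k, 2 * a (k + 1) ≤ c * a k + d k) :
    ∑' k, a k ≠ ⊤ := by
  set B := 2 * a 0 + ∑' k, d k with hB
  have hBt : B ≠ ⊤ := ENNReal.add_ne_top.2 ⟨ENNReal.mul_ne_top ENNReal.ofNat_ne_top (ha 0), hd⟩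
  have hsum : ∀ N, (2 - c) * ∑ k ∈ Finset.range (N + 1), a k ≤ B := by
    intro N
    set A := ∑ k ∈ Finset.range (N + 1), a k with hA
    have hAt : A ≠ ⊤ := ENNReal.sum_ne_top.2 fun k _ => ha k
    have hcA : c * A ≠ ⊤ := ENNReal.mul_ne_top hc.ne_top hAt
    refine (ENNReal.add_le_add_iff_right hcA).1 ?_
    rw [← add_mul, tsub_add_cancel_of_le hc.le]
    calc 2 * A = 2 * a 0 + ∑ k ∈ Finset.range N, 2 * a (k + 1) := by
          rw [hA, Finset.sum_range_succ', mul_add, Finset.mul_sum, add_comm]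
      _ ≤ 2 * a 0 + ∑ k ∈ Finset.range N, (c * a k + d k) := by
          gcongr with k; exact h k
      _ ≤ 2 * a 0 + (c * A + ∑' k, d k) := by
          rw [Finset.sum_add_distrib, ← Finset.mul_sum, hA]
          gcongr
          · exact Nat.le_succ N
          · exact ENNReal.sum_le_tsum _
      _ = B + c * A := by rw [hB]; ring
  have h2c : 2 - c ≠ 0 := (tsub_pos_of_lt hc).ne'
  have h2c' : 2 - c ≠ ⊤ := ne_top_of_le_ne_top ENNReal.ofNat_ne_top tsub_le_self
  refine ne_top_of_le_ne_top (ENNReal.div_ne_top hBt h2c)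
    (ENNReal.tsum_le_of_sum_range_le fun N => ?_)
  rw [ENNReal.le_div_iff_mul_le (Or.inl h2c) (Or.inl h2c'), mul_comm]
  refine le_trans ?_ (hsum N)
  gcongr
  exact Nat.le_succ N

/-- The terms grow geometrically, so their sum is comparable to the last admissible one, where b
2^{-k} is still at least d/M. -/
lemma tsum_rpow_indicator_le {α M b d : ℝ} (hα : 0 < α) (hM : 0 < M) (hb : 0 < b) (hd : 0 < d) :
    ∑' k : ℕ, {k : ℕ | d ≤ M * (b * (1 / 2) ^ k)}.indicator
        (fun k : ℕ => ENNReal.ofReal ((b * (1 / 2) ^ k) ^ (-α))) k ≤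
      ENNReal.ofReal (M ^ α / (1 - 2 ^ (-α)) * (1 / d ^ α)) := by
  have h2 : (2 : ℝ) ^ (-α) < 1 := Real.rpow_lt_one_of_one_lt_of_neg one_lt_two (by linarith)
  have h2' : 0 < 1 - (2 : ℝ) ^ (-α) := by linarith
  have hgeo : ∀ N : ℕ, ∑ k ∈ Finset.range (N + 1), (b * (1 / 2) ^ k) ^ (-α) ≤
      (b * (1 / 2) ^ N) ^ (-α) / (1 - 2 ^ (-α)) := by
    intro N
    induction N with
    | zero =>
      simp only [zero_add, Finset.sum_range_one, pow_zero, mul_one]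
      rw [le_div_iff₀ h2']
      have : 0 ≤ b ^ (-α) * 2 ^ (-α) := by positivity
      linarith
    | succ N ih =>
      rw [Finset.sum_range_succ]
      have e : (b * (1 / 2) ^ N : ℝ) ^ (-α) = (b * (1 / 2) ^ (N + 1)) ^ (-α) * 2 ^ (-α) := by
        rw [← Real.mul_rpow (by positivity) (by norm_num)]
        congr 1
        rw [pow_succ]
        ring
      rw [e] at ih
      refine (add_le_add_left ih _).trans_eq ?_
      field_simp
      ring
  refine ENNReal.tsum_le_of_sum_range_le fun N => ?_
  induction N with
  | zero => simp
  | succ N ih =>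
    by_cases hN : d ≤ M * (b * (1 / 2) ^ N)
    · calc _ ≤ ∑ k ∈ Finset.range (N + 1), ENNReal.ofReal ((b * (1 / 2) ^ k) ^ (-α)) :=
            Finset.sum_le_sum fun k _ => indicator_le_self' (fun _ _ => zero_le) k
        _ = ENNReal.ofReal (∑ k ∈ Finset.range (N + 1), (b * (1 / 2) ^ k) ^ (-α)) :=
            (ENNReal.ofReal_sum_of_nonneg fun k _ => by positivity).symm
        _ ≤ _ := by
            refine ENNReal.ofReal_le_ofReal ((hgeo N).trans ?_)
            rw [div_mul_eq_mul_div]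
            refine div_le_div_of_nonneg_right ?_ h2'.le
            have h3 : d / M ≤ b * (1 / 2) ^ N := by rw [div_le_iff₀ hM, mul_comm]; exact hN
            refine (Real.rpow_le_rpow_of_nonpos (by positivity) h3 (by linarith)).trans_eq ?_
            rw [Real.div_rpow hd.le hM.le, Real.rpow_neg hM.le, Real.rpow_neg hd.le]
            field_simp
    · rw [Finset.sum_range_succ, indicator_of_notMem (by exact hN), add_zero]
      exact ih

/-- One term suffices: the k with b 2^{-k-1} < t ≤ b 2^{-k}. -/
lemma rpow_neg_le_tsum {b t : ℝ} (hs₀ : 0 < s) (hb : 0 < b) (ht : 0 < t) (htb : t ≤ b) :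
    ENNReal.ofReal (t ^ (-s)) ≤ ENNReal.ofReal (2 ^ s) *
      ∑' k : ℕ, {k : ℕ | t ≤ b * (1 / 2) ^ k}.indicator
        (fun k : ℕ => ENNReal.ofReal ((b * (1 / 2) ^ k) ^ (-s))) k := by
  obtain ⟨k, hk1, hk2⟩ := exists_nat_pow_near_of_lt_one (x := t / b) (y := (1 / 2 : ℝ))
    (by positivity) ((div_le_one hb).2 htb) (by norm_num) (by norm_num)
  rw [lt_div_iff₀ hb, mul_comm] at hk1
  rw [div_le_iff₀ hb, mul_comm] at hk2
  refine le_trans ?_ (mul_le_mul_right (ENNReal.le_tsum k) _)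
  rw [indicator_of_mem (by exact hk2), ← ENNReal.ofReal_mul (by positivity)]
  refine ENNReal.ofReal_le_ofReal ?_
  refine (Real.rpow_le_rpow_of_nonpos (by positivity) hk1.le (by linarith)).trans_eq ?_
  rw [pow_succ, ← mul_assoc, Real.mul_rpow (by positivity) (by positivity), mul_comm]
  congr 1
  rw [one_div, Real.inv_rpow (by norm_num), Real.rpow_neg (by norm_num), inv_inv]

/-! ### The Hardy inequality near a boundary point -/

section LocalHardy

variable {p ν : EuclideanSpace ℝ (Fin n)} {h : EuclideanSpace ℝ (Fin n) → ℝ} {L r : ℝ}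
  {Ω : Set (EuclideanSpace ℝ (Fin n))} {w : EuclideanSpace ℝ (Fin n) → ℝ}

/-- The points of height in `(0, τ]` in a cylinder of radius `b` around `p` in direction `ν`. -/
def boundaryLayer {n : ℕ} (p ν : EuclideanSpace ℝ (Fin n)) (h : EuclideanSpace ℝ (Fin n) → ℝ)
    (b τ : ℝ) : Set (EuclideanSpace ℝ (Fin n)) :=
  {x | ‖x - p - h x • ν‖ < b ∧ 0 < h x ∧ h x ≤ τ}

lemma measurableSet_boundaryLayer (hh : Continuous h) (b τ : ℝ) :
    MeasurableSet (boundaryLayer p ν h b τ) := by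
  have hq : Measurable fun x => ‖x - p - h x • ν‖ := Continuous.measurable (by fun_prop)
  exact (measurableSet_lt hq measurable_const).inter
    ((measurableSet_lt measurable_const hh.measurable).inter
      (measurableSet_le hh.measurable measurable_const))

lemma norm_sub_lt_of_mem_boundaryLayer (hν : ‖ν‖ = 1) {b τ : ℝ} {x : 𝔼}
    (hx : x ∈ boundaryLayer p ν h b τ) : ‖x - p‖ < b + τ := by
  have h1 : ‖x - p‖ ≤ ‖x - p - h x • ν‖ + ‖h x • ν‖ := by
    simpa using norm_add_le (x - p - h x • ν) (h x • ν)
  rw [norm_smul, hν, mul_one, Real.norm_of_nonneg hx.2.1.le] at h1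
  linarith [hx.1, hx.2.2]

/-- The layer and its translate by τν are disjoint and both lie in the layer of height 2τ; the mass
of w on the layer exceeds that on the translate by at most the integral of the increment. -/
lemma two_mul_lintegral_boundaryLayer_le (hh : Continuous h)
    (hadd : ∀ x t, h (x + t • ν) = h x + t) (hw : Measurable w) (b : ℝ) {τ : ℝ} (hτ : 0 < τ) :
    2 * ∫⁻ x in boundaryLayer p ν h b τ, ‖w x‖ₑ ≤
      (∫⁻ x in boundaryLayer p ν h b (2 * τ), ‖w x‖ₑ) +
        ∫⁻ x in boundaryLayer p ν h b τ, ‖w x - w (x + τ • ν)‖ₑ := by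
  set S := boundaryLayer p ν h b τ with hS
  have hSm : MeasurableSet S := measurableSet_boundaryLayer hh b τ
  set S' : Set 𝔼 := {x | x - τ • ν ∈ S} with hS'
  have hS'm : MeasurableSet S' := hSm.preimage (by fun_prop)
  have htrans : ∫⁻ x in S, ‖w (x + τ • ν)‖ₑ = ∫⁻ x in S', ‖w x‖ₑ := by
    rw [← lintegral_indicator hSm, ← lintegral_indicator hS'm,
      ← lintegral_add_right_eq_self (S'.indicator fun x => ‖w x‖ₑ) (τ • ν)]
    refine lintegral_congr fun x => ?_
    have : x + τ • ν ∈ S' ↔ x ∈ S := by simp [hS']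
    by_cases hx : x ∈ S
    · rw [indicator_of_mem hx, indicator_of_mem (this.2 hx)]
    · rw [indicator_of_notMem hx, indicator_of_notMem (fun h' => hx (this.1 h'))]
  have hdisj : Disjoint S S' := by
    refine disjoint_left.2 fun x hx hx' => ?_
    have h1 : 0 < h (x - τ • ν) := hx'.2.1
    have h2 := hadd (x - τ • ν) τ
    rw [sub_add_cancel] at h2
    linarith [hx.2.2]
  have hsub : S ∪ S' ⊆ boundaryLayer p ν h b (2 * τ) := by
    rintro x (hx | hx)
    · exact ⟨hx.1, hx.2.1, by linarith [hx.2.2]⟩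
    · have h2 := hadd (x - τ • ν) τ
      rw [sub_add_cancel] at h2
      refine ⟨?_, by linarith [hx.2.1], by linarith [hx.2.2]⟩
      convert hx.1 using 2
      rw [h2, add_smul]
      abel
  have h1 : ∫⁻ x in S, ‖w x‖ₑ ≤ (∫⁻ x in S', ‖w x‖ₑ) + ∫⁻ x in S, ‖w x - w (x + τ • ν)‖ₑ := by
    rw [← htrans, ← lintegral_add_left (by fun_prop)]
    refine lintegral_mono fun x => ?_
    have := enorm_add_le (w (x + τ • ν)) (w x - w (x + τ • ν))
    simpa using this
  calc 2 * ∫⁻ x in S, ‖w x‖ₑ = (∫⁻ x in S, ‖w x‖ₑ) + ∫⁻ x in S, ‖w x‖ₑ := two_mul _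
    _ ≤ (∫⁻ x in S, ‖w x‖ₑ) + ((∫⁻ x in S', ‖w x‖ₑ) + ∫⁻ x in S, ‖w x - w (x + τ • ν)‖ₑ) := by
        gcongr
    _ = (∫⁻ x in S ∪ S', ‖w x‖ₑ) + ∫⁻ x in S, ‖w x - w (x + τ • ν)‖ₑ := by
        rw [lintegral_union hS'm hdisj, add_assoc]
    _ ≤ _ := by gcongr

/-- The increment from x to x + τν is compared with w(y) by the triangle inequality and averaged
over y in a ball of radius τ inside Ω at distance of order τ from both points. This turns increments
in one direction into the double integral of the Gagliardo seminorm. -/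
lemma lintegral_boundaryLayer_sub_le (hν : ‖ν‖ = 1) (hL : 0 < L)
    (hlip : ∀ x y, |h x - h y| ≤ L * ‖x - y‖) (hh : Continuous h)
    (hadd : ∀ x t, h (x + t • ν) = h x + t) (hΩm : MeasurableSet Ω)
    (hΩ : ∀ x ∈ ball p r, (x ∈ Ω ↔ 0 < h x)) (hw : Measurable w)
    {b τ : ℝ} (hbr : (L + 4) * b ≤ r) (hτ : 0 < τ) (hτb : τ ≤ b) :
    volume (ball (0 : 𝔼) 1) * ENNReal.ofReal (τ ^ n) *
        ∫⁻ x in boundaryLayer p ν h b τ, ‖w x - w (x + τ • ν)‖ₑ ≤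
      2 * ∫⁻ x in Ω, ∫⁻ y in Ω, {q : 𝔼 × 𝔼 | ‖q.1 - q.2‖ ≤ (L + 2) * τ}.indicator
        (fun q => ‖w q.1 - w q.2‖ₑ) (x, y) := by
  set S := boundaryLayer p ν h b τ with hS
  have hSm : MeasurableSet S := measurableSet_boundaryLayer hh b τ
  set k : 𝔼 × 𝔼 → ℝ≥0∞ := {q : 𝔼 × 𝔼 | ‖q.1 - q.2‖ ≤ (L + 2) * τ}.indicator
    (fun q => ‖w q.1 - w q.2‖ₑ) with hk
  have hkm : Measurable k :=
    Measurable.indicator (by fun_prop) (measurableSet_le (by fun_prop) measurable_const)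
  set Φ : 𝔼 → ℝ≥0∞ := fun x => ∫⁻ y in Ω, k (x, y) with hΦ
  have hΦm : Measurable Φ := hkm.lintegral_prod_right'
  -- The constant L + 4 arises here: |x - p| < b + τ ≤ 2b, and y is within (L + 2)τ ≤ (L + 2)b of x.
  have hmem : ∀ x ∈ S, ∀ y, ‖y - x‖ ≤ (L + 2) * τ → 0 < h y → y ∈ Ω := by
    intro x hx y hyx hy
    refine (hΩ y ?_).2 hy
    rw [mem_ball, dist_eq_norm]
    have h1 := norm_sub_lt_of_mem_boundaryLayer hν hx
    have h2 : ‖y - p‖ ≤ ‖y - x‖ + ‖x - p‖ := by simpa using norm_add_le (y - x) (x - p)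
    nlinarith
  have hSΩ : S ⊆ Ω := fun x hx => hmem x hx x (by simp; positivity) hx.2.1
  have hτν : ‖τ • ν‖ = τ := by rw [norm_smul, hν, mul_one, Real.norm_of_nonneg hτ.le]
  have hSΩ' : ∀ x ∈ S, x + τ • ν ∈ Ω := fun x hx => by
    refine hmem x hx _ ?_ (by rw [hadd]; linarith [hx.2.1])
    rw [add_sub_cancel_left, hτν]
    nlinarith
  have hpt : ∀ x ∈ S, volume (ball (0 : 𝔼) 1) * ENNReal.ofReal (τ ^ n) *
      ‖w x - w (x + τ • ν)‖ₑ ≤ Φ x + Φ (x + τ • ν) := by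
    intro x hx
    -- The centre has height h x + (L + 1)τ, and heights vary by at most Lτ over the ball, so the
    -- ball stays above the graph.
    set c : 𝔼 := x + ((L + 1) * τ) • ν with hc
    have hcx : ‖c - x‖ = (L + 1) * τ := by
      rw [hc, add_sub_cancel_left, norm_smul, hν, mul_one, Real.norm_of_nonneg (by positivity)]
    have hcx' : ‖c - (x + τ • ν)‖ = L * τ := by
      have : c - (x + τ • ν) = (L * τ) • ν := by rw [hc]; module
      rw [this, norm_smul, hν, mul_one, Real.norm_of_nonneg (by positivity)]
    have hy1 : ∀ y ∈ ball c τ, ‖x - y‖ ≤ (L + 2) * τ := fun y hy => by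
      rw [mem_ball, dist_eq_norm] at hy
      have : ‖y - x‖ ≤ ‖y - c‖ + ‖c - x‖ := by simpa using norm_add_le (y - c) (c - x)
      rw [norm_sub_rev]
      linarith
    have hy2 : ∀ y ∈ ball c τ, ‖x + τ • ν - y‖ ≤ (L + 2) * τ := fun y hy => by
      rw [mem_ball, dist_eq_norm] at hy
      have : ‖y - (x + τ • ν)‖ ≤ ‖y - c‖ + ‖c - (x + τ • ν)‖ := by
        simpa using norm_add_le (y - c) (c - (x + τ • ν))
      rw [norm_sub_rev]
      linarith
    have hcΩ : ball c τ ⊆ Ω := fun y hy => by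
      refine hmem x hx y (by rw [norm_sub_rev]; exact hy1 y hy) ?_
      have h1 := (abs_le.1 (hlip y c)).1
      rw [mem_ball, dist_eq_norm] at hy
      have h2 : h c = h x + (L + 1) * τ := hadd _ _
      have h3 : L * ‖y - c‖ ≤ L * τ := by gcongr
      nlinarith [hx.2.1]
    calc volume (ball (0 : 𝔼) 1) * ENNReal.ofReal (τ ^ n) * ‖w x - w (x + τ • ν)‖ₑ
        = ∫⁻ _ in ball c τ, ‖w x - w (x + τ • ν)‖ₑ := by
          rw [setLIntegral_const, Measure.addHaar_ball_of_pos volume c hτ,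
            finrank_euclideanSpace_fin]
          ring
      _ ≤ ∫⁻ y in ball c τ, (k (x, y) + k (x + τ • ν, y)) := by
          refine setLIntegral_mono' measurableSet_ball fun y hy => ?_
          rw [hk, indicator_of_mem (by exact hy1 y hy), indicator_of_mem (by exact hy2 y hy)]
          simpa [edist_eq_enorm_sub] using edist_triangle_right (w x) (w (x + τ • ν)) (w y)
      _ = (∫⁻ y in ball c τ, k (x, y)) + ∫⁻ y in ball c τ, k (x + τ • ν, y) :=
          lintegral_add_left (by fun_prop) _
      _ ≤ Φ x + Φ (x + τ • ν) := add_le_add (lintegral_mono_set hcΩ) (lintegral_mono_set hcΩ)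
  have hΦΩ : ∫⁻ x in S, Φ (x + τ • ν) ≤ ∫⁻ x in Ω, Φ x := by
    rw [← lintegral_indicator hSm, ← lintegral_indicator hΩm,
      ← lintegral_add_right_eq_self (Ω.indicator Φ) (τ • ν)]
    refine lintegral_mono fun x => ?_
    by_cases hx : x ∈ S
    · rw [indicator_of_mem hx, indicator_of_mem (hSΩ' x hx)]
    · rw [indicator_of_notMem hx]; exact zero_le
  rw [← lintegral_const_mul _ (by fun_prop)]
  calc _ ≤ ∫⁻ x in S, (Φ x + Φ (x + τ • ν)) := setLIntegral_mono' hSm hpt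
    _ = (∫⁻ x in S, Φ x) + ∫⁻ x in S, Φ (x + τ • ν) := lintegral_add_left hΦm _
    _ ≤ (∫⁻ x in Ω, Φ x) + ∫⁻ x in Ω, Φ x := add_le_add (lintegral_mono_set hSΩ) hΦΩ
    _ = _ := (two_mul _).symm

/-- The fractional Hardy inequality near a boundary point. -/
lemma lintegral_boundaryLayer_rpow_ne_top (hn : 1 ≤ n) (hs₀ : 0 < s) (hs₁ : s < 1)
    (hν : ‖ν‖ = 1) (hL : 0 < L) (hlip : ∀ x y, |h x - h y| ≤ L * ‖x - y‖) (hh : Continuous h)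
    (hadd : ∀ x t, h (x + t • ν) = h x + t) (hΩm : MeasurableSet Ω)
    (hΩ : ∀ x ∈ ball p r, (x ∈ Ω ↔ 0 < h x)) (hw : Measurable w)
    {b : ℝ} (hb : 0 < b) (hbr : (L + 4) * b ≤ r) (hw1 : ∫⁻ x in Ω, ‖w x‖ₑ ≠ ⊤)
    (hG : ∫⁻ x in Ω, ∫⁻ y in Ω, ‖w x - w y‖ₑ * fracKernel n s (x - y) ≠ ⊤) :
    ∫⁻ x in boundaryLayer p ν h b b, ‖w x‖ₑ * ENNReal.ofReal (h x ^ (-s)) ≠ ⊤ := by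
  set τ : ℕ → ℝ := fun k => b * (1 / 2) ^ k with hτ
  have hτ0 : ∀ k, 0 < τ k := fun k => by positivity
  have hτb : ∀ k, τ k ≤ b := fun k =>
    mul_le_of_le_one_right hb.le (pow_le_one₀ (by norm_num) (by norm_num))
  have hτs : ∀ k, 2 * τ (k + 1) = τ k := fun k => by simp only [hτ, pow_succ]; ring
  set m : ℕ → ℝ≥0∞ := fun k => ∫⁻ x in boundaryLayer p ν h b (τ k), ‖w x‖ₑ with hm
  set δ : ℕ → ℝ≥0∞ := fun k =>
    ∫⁻ x in boundaryLayer p ν h b (τ k), ‖w x - w (x + τ k • ν)‖ₑ with hδ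
  set D : ℕ → ℝ≥0∞ := fun k => ∫⁻ x in Ω, ∫⁻ y in Ω,
    {q : 𝔼 × 𝔼 | ‖q.1 - q.2‖ ≤ (L + 2) * τ k}.indicator (fun q => ‖w q.1 - w q.2‖ₑ) (x, y) with hD
  have hsubΩ : ∀ k, boundaryLayer p ν h b (τ k) ⊆ Ω := fun k x hx => by
    refine (hΩ x ?_).2 hx.2.1
    rw [mem_ball, dist_eq_norm]
    have := norm_sub_lt_of_mem_boundaryLayer hν hx
    nlinarith [hτb k]
  have hmt : ∀ k, m k ≠ ⊤ := fun k => ne_top_of_le_ne_top hw1 (lintegral_mono_set (hsubΩ k))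
  set ω := volume (ball (0 : 𝔼) 1) with hω
  have hω0 : ω ≠ 0 := (measure_ball_pos _ _ one_pos).ne'
  have hωt : ω ≠ ⊤ := measure_ball_lt_top.ne
  set α : ℝ := (n : ℝ) + s with hα
  have hα0 : 0 < α := by positivity
  -- Summing over scales first: for fixed x ≠ y, the sum of τ_k^{-n-s} over the scales with |x - y|
  -- ≤ (L + 2)τ_k is at most a constant times the kernel.
  have hDsum : ∑' k, ENNReal.ofReal (τ k ^ (-α)) * D k ≠ ⊤ := by
    set C : ℝ := (L + 2) ^ α / (1 - 2 ^ (-α)) with hC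
    have hkm : ∀ k, Measurable (fun q : 𝔼 × 𝔼 => {q : 𝔼 × 𝔼 | ‖q.1 - q.2‖ ≤ (L + 2) * τ k}.indicator
        (fun q => ‖w q.1 - w q.2‖ₑ) q) := fun k =>
      Measurable.indicator (by fun_prop) (measurableSet_le (by fun_prop) measurable_const)
    have hin : ∀ k x, Measurable fun y : 𝔼 => ENNReal.ofReal (τ k ^ (-α)) *
        {q : 𝔼 × 𝔼 | ‖q.1 - q.2‖ ≤ (L + 2) * τ k}.indicator (fun q => ‖w q.1 - w q.2‖ₑ) (x, y) :=
      fun k x => ((hkm k).comp measurable_prodMk_left).const_mul _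
    refine ne_top_of_le_ne_top (ENNReal.mul_ne_top (ENNReal.ofReal_ne_top (r := C)) hG) ?_
    simp only [hD]
    rw [← lintegral_const_mul' _ _ ENNReal.ofReal_ne_top]
    simp_rw [← lintegral_const_mul' _ _ ENNReal.ofReal_ne_top]
    rw [← lintegral_tsum fun k => ?_]
    swap
    · exact (((hkm k).const_mul (ENNReal.ofReal (τ k ^ (-α)))).lintegral_prod_right').aemeasurable
    refine lintegral_mono fun x => ?_
    rw [← lintegral_tsum fun k => (hin k x).aemeasurable]
    refine lintegral_mono fun y => ?_
    rcases eq_or_ne x y with rfl | hxy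
    · simp [indicator]
    have hd : 0 < ‖x - y‖ := norm_pos_iff.2 (sub_ne_zero.2 hxy)
    have hle := tsum_rpow_indicator_le hα0 (by positivity : 0 < L + 2) hb hd
    rw [ENNReal.ofReal_mul' (by positivity)] at hle
    calc _ = ‖w x - w y‖ₑ * ∑' k : ℕ, {k : ℕ | ‖x - y‖ ≤ (L + 2) * (b * (1 / 2) ^ k)}.indicator
            (fun k : ℕ => ENNReal.ofReal ((b * (1 / 2) ^ k) ^ (-α))) k := by
          rw [← ENNReal.tsum_mul_left]
          refine tsum_congr fun k => ?_
          by_cases hk : ‖x - y‖ ≤ (L + 2) * (b * (1 / 2) ^ k)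
          · rw [indicator_of_mem (by exact hk), indicator_of_mem (by exact hk), mul_comm]
          · rw [indicator_of_notMem (by exact hk), indicator_of_notMem (by exact hk), mul_zero,
              mul_zero]
      _ ≤ ‖w x - w y‖ₑ * (ENNReal.ofReal C * fracKernel n s (x - y)) := by
          gcongr
          exact hle
      _ = _ := by ring
  have hδsum : ∑' k, ENNReal.ofReal (τ (k + 1) ^ (-s)) * δ (k + 1) ≠ ⊤ := by
    refine ne_top_of_le_ne_top (ENNReal.mul_ne_top (ENNReal.mul_ne_top
      (ENNReal.inv_ne_top.2 hω0) (ENNReal.ofNat_ne_top (n := 2))) hDsum) ?_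
    refine (ENNReal.tsum_comp_le_tsum_of_injective (add_left_injective 1)
      (fun k => ENNReal.ofReal (τ k ^ (-s)) * δ k)).trans ?_
    rw [← ENNReal.tsum_mul_left (a := ω⁻¹ * 2)]
    refine ENNReal.tsum_le_tsum fun k => ?_
    have h1 := lintegral_boundaryLayer_sub_le hν hL hlip hh hadd hΩm hΩ hw hbr (hτ0 k) (hτb k)
    have e1 : ENNReal.ofReal (τ k ^ (-s)) =
        ENNReal.ofReal (τ k ^ (-α)) * ENNReal.ofReal (τ k ^ n) := by
      rw [← ENNReal.ofReal_mul (by have := hτ0 k; positivity), ← Real.rpow_natCast,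
        ← Real.rpow_add (hτ0 k), hα]
      congr 2
      ring
    calc ENNReal.ofReal (τ k ^ (-s)) * δ k
        = ω⁻¹ * ENNReal.ofReal (τ k ^ (-α)) * (ω * ENNReal.ofReal (τ k ^ n) * δ k) := by
          rw [e1, show ω⁻¹ * ENNReal.ofReal (τ k ^ (-α)) * (ω * ENNReal.ofReal (τ k ^ n) * δ k) =
            (ω⁻¹ * ω) * (ENNReal.ofReal (τ k ^ (-α)) * ENNReal.ofReal (τ k ^ n) * δ k) by ring,
            ENNReal.inv_mul_cancel hω0 hωt, one_mul]
      _ ≤ ω⁻¹ * ENNReal.ofReal (τ k ^ (-α)) * (2 * D k) := by gcongr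
      _ = _ := by ring
  -- Weighted by τ_k^{-s}, the recursion 2 m_{k+1} ≤ m_k + δ_{k+1} acquires the factor 2^s, and
  -- absorption needs 2^s < 2, that is, s < 1.
  have hmain : ∑' k, ENNReal.ofReal (τ k ^ (-s)) * m k ≠ ⊤ := by
    refine tsum_ne_top_of_two_mul_le (c := ENNReal.ofReal (2 ^ s))
      (d := fun k => ENNReal.ofReal (τ (k + 1) ^ (-s)) * δ (k + 1)) ?_
      (fun k => ENNReal.mul_ne_top ENNReal.ofReal_ne_top (hmt k)) hδsum fun k => ?_
    · rw [show (2 : ℝ≥0∞) = ENNReal.ofReal 2 by simp, ENNReal.ofReal_lt_ofReal_iff zero_lt_two]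
      calc (2 : ℝ) ^ s < 2 ^ (1 : ℝ) := Real.rpow_lt_rpow_of_exponent_lt one_lt_two hs₁
        _ = 2 := Real.rpow_one 2
    · have h1 := two_mul_lintegral_boundaryLayer_le (p := p) hh hadd hw b (hτ0 (k + 1))
      rw [hτs] at h1
      have e : ENNReal.ofReal (τ (k + 1) ^ (-s)) =
          ENNReal.ofReal (2 ^ s) * ENNReal.ofReal (τ k ^ (-s)) := by
        rw [← ENNReal.ofReal_mul (by positivity), ← hτs k, Real.mul_rpow zero_le_two (hτ0 _).le,
          ← mul_assoc, ← Real.rpow_add zero_lt_two, add_neg_cancel, Real.rpow_zero, one_mul]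
      calc 2 * (ENNReal.ofReal (τ (k + 1) ^ (-s)) * m (k + 1))
          = ENNReal.ofReal (τ (k + 1) ^ (-s)) * (2 * m (k + 1)) := by ring
        _ ≤ ENNReal.ofReal (τ (k + 1) ^ (-s)) * (m k + δ (k + 1)) := by gcongr
        _ = _ := by rw [mul_add, e, mul_assoc, mul_assoc]
  have hSm : ∀ k, MeasurableSet (boundaryLayer p ν h b (τ k)) := fun k =>
    measurableSet_boundaryLayer hh b _
  refine ne_top_of_le_ne_top (ENNReal.mul_ne_top (ENNReal.ofReal_ne_top (r := 2 ^ s)) hmain) ?_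
  simp only [hm]
  simp_rw [← lintegral_const_mul' _ _ ENNReal.ofReal_ne_top, ← lintegral_indicator (hSm _)]
  rw [← lintegral_tsum fun k => (Measurable.indicator (by fun_prop) (hSm k)).aemeasurable,
    ← lintegral_const_mul' _ _ ENNReal.ofReal_ne_top,
    ← lintegral_indicator (measurableSet_boundaryLayer hh b b)]
  refine lintegral_mono fun x => ?_
  by_cases hx : x ∈ boundaryLayer p ν h b b
  swap
  · rw [indicator_of_notMem hx]; exact zero_le
  rw [indicator_of_mem hx]
  calc ‖w x‖ₑ * ENNReal.ofReal (h x ^ (-s))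
      ≤ ‖w x‖ₑ * (ENNReal.ofReal (2 ^ s) * ∑' k : ℕ, {k : ℕ | h x ≤ b * (1 / 2) ^ k}.indicator
        (fun k : ℕ => ENNReal.ofReal ((b * (1 / 2) ^ k) ^ (-s))) k) := by
        gcongr
        exact rpow_neg_le_tsum hs₀ hb hx.2.1 hx.2.2
    _ = ENNReal.ofReal (2 ^ s) * ∑' k : ℕ, ‖w x‖ₑ *
        {k : ℕ | h x ≤ b * (1 / 2) ^ k}.indicator
          (fun k : ℕ => ENNReal.ofReal ((b * (1 / 2) ^ k) ^ (-s))) k := by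
        rw [ENNReal.tsum_mul_left]; ring
    _ = _ := by
        congr 1
        refine tsum_congr fun k => ?_
        by_cases hk : h x ≤ b * (1 / 2) ^ k
        · rw [indicator_of_mem (by exact hk), indicator_of_mem (by exact ⟨hx.1, hx.2.1, hk⟩),
            mul_comm]
        · rw [indicator_of_notMem (by exact hk), indicator_of_notMem (fun hx' => hk hx'.2.2),
            mul_zero]

end LocalHardy

/-! ### The Hardy inequality in Lipschitz domains -/

/-- The height of a point over a Lipschitz graph in direction `ν`. -/
lemma exists_height {Ω : Set 𝔼} (hΩo : IsOpen Ω) (hΩ : HasLipschitzBoundary Ω) {p : 𝔼}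
    (hp : p ∈ frontier Ω) :
    ∃ (ν : 𝔼) (h : 𝔼 → ℝ) (L r : ℝ), ‖ν‖ = 1 ∧ 0 < L ∧ 0 < r ∧
      (∀ x y, |h x - h y| ≤ L * ‖x - y‖) ∧ Continuous h ∧ (∀ x t, h (x + t • ν) = h x + t) ∧
      (∀ x ∈ ball p r, (x ∈ Ω ↔ 0 < h x)) ∧ h p = 0 := by
  obtain ⟨ν, hν, g, K, hg, r, hr, hgr⟩ := hΩ p hp
  set P := (Submodule.span ℝ {ν})ᗮ.orthogonalProjectionOnto with hP
  set h : 𝔼 → ℝ := fun x => inner ℝ ν x - g (P x) with hh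
  have hlip : ∀ x y, |h x - h y| ≤ (1 + K) * ‖x - y‖ := by
    intro x y
    have h1 : |inner ℝ ν (x - y)| ≤ ‖x - y‖ := by
      simpa [hν] using abs_real_inner_le_norm ν (x - y)
    have h2 : |g (P x) - g (P y)| ≤ K * ‖x - y‖ := by
      have h3 := hg.dist_le_mul (P x) (P y)
      rw [Real.dist_eq, dist_eq_norm, ← map_sub] at h3
      exact h3.trans (mul_le_mul_of_nonneg_left
        (Submodule.norm_orthogonalProjectionOnto_apply_le _ _) K.2)
    rw [inner_sub_right] at h1
    calc |h x - h y| = |(inner ℝ ν x - inner ℝ ν y) - (g (P x) - g (P y))| := by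
          simp only [hh]; congr 1; ring
      _ ≤ _ := (abs_sub _ _).trans (by linarith)
  have hcont : Continuous h :=
    (continuous_const.inner continuous_id).sub (hg.continuous.comp P.continuous)
  have hr' : ∀ x ∈ ball p r, (x ∈ Ω ↔ 0 < h x) := fun x hx => by
    rw [hgr x hx, hh, sub_pos]
  refine ⟨ν, h, 1 + K, r, hν, by positivity, hr, hlip, hcont, fun x t => ?_, hr', ?_⟩
  · have hPν : P ν = 0 := by
      rw [hP, Submodule.orthogonalProjectionOnto_eq_zero_iff]
      exact Submodule.le_orthogonal_orthogonal _ (Submodule.mem_span_singleton_self ν)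
    simp only [hh, map_add, map_smul, hPν, smul_zero, add_zero, inner_add_right, inner_smul_right,
      real_inner_self_eq_norm_sq, hν]
    ring
  · have hpΩ : p ∉ Ω := by
      rw [hΩo.frontier_eq] at hp
      exact hp.2
    refine le_antisymm (not_lt.1 fun h0 => hpΩ ((hr' p (mem_ball_self hr)).2 h0)) ?_
    have hcl : p ∈ closure (Ω ∩ ball p r) := by
      refine isOpen_ball.closure_inter ⟨frontier_subset_closure hp, mem_ball_self hr⟩
    refine closure_minimal (t := {x | 0 ≤ h x}) (fun x hx => ((hr' x hx.2).1 hx.1).le)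
      (isClosed_le continuous_const hcont) hcl

/-- The fractional Hardy inequality in bounded Lipschitz domains, for `s < 1`. -/
lemma lintegral_mul_interaction_compl_ne_top (hn : 1 ≤ n) (hs₀ : 0 < s) (hs₁ : s < 1) {Ω : Set 𝔼}
    (hΩo : IsOpen Ω) (hΩb : Bornology.IsBounded Ω) (hΩ : HasLipschitzBoundary Ω) {w : 𝔼 → ℝ}
    (hw : Measurable w) (hw1 : ∫⁻ x in Ω, ‖w x‖ₑ ≠ ⊤)
    (hG : ∫⁻ x in Ω, ∫⁻ y in Ω, ‖w x - w y‖ₑ * fracKernel n s (x - y) ≠ ⊤) :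
    ∫⁻ x in Ω, ‖w x‖ₑ * ∫⁻ y in Ωᶜ, fracKernel n s (x - y) ≠ ⊤ := by
  set F : 𝔼 → ℝ≥0∞ := fun x => ‖w x‖ₑ * ∫⁻ y in Ωᶜ, fracKernel n s (x - y) with hF
  have hΩm := hΩo.measurableSet
  have hfar : ∀ (U : Set 𝔼) (ρ : ℝ), 0 < ρ → IsOpen U → (∀ x ∈ U, ∀ y ∈ Ωᶜ, ρ ≤ ‖x - y‖) →
      ∫⁻ x in U ∩ Ω, F x ≠ ⊤ := by
    intro U ρ hρ hU hd
    refine ne_top_of_le_ne_top (ENNReal.mul_ne_top (kernelTail_ne_top (n := n) hs₀ hρ) hw1) ?_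
    rw [← lintegral_const_mul _ (by fun_prop)]
    refine le_trans (setLIntegral_mono' (hU.measurableSet.inter hΩm) fun x hx => ?_)
      (lintegral_mono_set inter_subset_right)
    rw [mul_comm]
    exact mul_le_mul_right (lintegral_fracKernel_le_tail (Eventually.of_forall (hd x hx.1))) _
  have hloc : ∀ p ∈ closure Ω, ∃ U ∈ 𝓝[closure Ω] p, ∫⁻ x in U ∩ Ω, F x ≠ ⊤ := by
    intro p hp
    by_cases hpΩ : p ∈ Ω
    · obtain ⟨ρ, hρ, hball⟩ := Metric.isOpen_iff.1 hΩo p hpΩ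
      refine ⟨ball p (ρ / 2), mem_nhdsWithin_of_mem_nhds (ball_mem_nhds _ (by linarith)),
        hfar _ (ρ / 2) (by linarith) isOpen_ball fun x hx y hy => ?_⟩
      have h1 : ρ ≤ dist y p := not_lt.1 fun h => hy (hball h)
      have h2 : dist x p < ρ / 2 := hx
      have h3 := dist_triangle y x p
      rw [← dist_eq_norm, dist_comm x y]
      linarith
    · have hpf : p ∈ frontier Ω := by rw [hΩo.frontier_eq]; exact ⟨hp, hpΩ⟩
      obtain ⟨ν, h, L, r, hν, hL, hr, hlip, hcont, hadd, hr', hp0⟩ := exists_height hΩo hΩ hpf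
      set b := r / (L + 4) with hb
      have hb0 : 0 < b := by positivity
      have hbr : (L + 4) * b ≤ r := by rw [hb, mul_div_cancel₀ _ (by positivity)]
      have hmain := lintegral_boundaryLayer_rpow_ne_top hn hs₀ hs₁ hν hL hlip hcont hadd hΩm hr' hw
        hb0 hbr hw1 hG
      set U : Set 𝔼 := {x | ‖x - p - h x • ν‖ < b} ∩ ({x | h x < b} ∩ ball p (r / 2)) with hU
      have hUo : IsOpen U := (isOpen_lt (by fun_prop) continuous_const).inter
        ((isOpen_lt hcont continuous_const).inter isOpen_ball)
      have hUp : p ∈ U := ⟨by simp [hp0, hb0], by simp [hp0, hb0], mem_ball_self (by linarith)⟩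
      have hsub : U ∩ Ω ⊆ boundaryLayer p ν h b b := fun x hx =>
        ⟨hx.1.1, (hr' x (ball_subset_ball (by linarith) hx.1.2.2)).1 hx.2, le_of_lt hx.1.2.1⟩
      refine ⟨U, mem_nhdsWithin_of_mem_nhds (hUo.mem_nhds hUp), ?_⟩
      set T := kernelTail n s 1 with hT
      have hTt : T ≠ ⊤ := kernelTail_one_ne_top hs₀
      -- Nearby points of Ωᶜ have height at most 0, hence distance at least h x / L from x; the
      -- remaining points are at distance at least r/2.
      have hint : ∀ x ∈ U ∩ Ω, ∫⁻ y in Ωᶜ, fracKernel n s (x - y) ≤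
          ENNReal.ofReal (L ^ s) * T * ENNReal.ofReal (h x ^ (-s)) + kernelTail n s (r / 2) := by
        intro x hx
        have hx0 : 0 < h x := (hsub hx).2.1
        have hxp : dist x p < r / 2 := hx.1.2.2
        calc ∫⁻ y in Ωᶜ, fracKernel n s (x - y)
            ≤ ∫⁻ y in (Ωᶜ ∩ ball p r) ∪ (ball p r)ᶜ, fracKernel n s (x - y) := by
              refine lintegral_mono_set fun y hy => ?_
              by_cases hyb : y ∈ ball p r
              · exact Or.inl ⟨hy, hyb⟩
              · exact Or.inr hyb
          _ ≤ (∫⁻ y in Ωᶜ ∩ ball p r, fracKernel n s (x - y)) +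
              ∫⁻ y in (ball p r)ᶜ, fracKernel n s (x - y) := lintegral_union_le _ _ _
          _ ≤ kernelTail n s (h x / L) + kernelTail n s (r / 2) := by
              refine add_le_add ?_ ?_
              · refine lintegral_fracKernel_le_tail (Eventually.of_forall fun y hy => ?_)
                have h1 : h y ≤ 0 := not_lt.1 fun h0 => hy.1 ((hr' y hy.2).2 h0)
                rw [div_le_iff₀ hL, mul_comm]
                linarith [(le_abs_self _).trans (hlip x y)]
              · refine lintegral_fracKernel_le_tail (Eventually.of_forall fun y hy => ?_)
                have h1 : r ≤ dist y p := not_lt.1 hy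
                have h3 := dist_triangle y x p
                rw [← dist_eq_norm, dist_comm x y]
                linarith
          _ = _ := by
              rw [kernelTail_eq (by positivity), Real.div_rpow hx0.le hL.le, Real.rpow_neg hL.le,
                div_inv_eq_mul, ENNReal.ofReal_mul (by positivity)]
              ring
      have hUm : MeasurableSet (U ∩ Ω) := hUo.measurableSet.inter hΩm
      have h1 : ∫⁻ x in U ∩ Ω, F x ≤
          (ENNReal.ofReal (L ^ s) * T *
            ∫⁻ x in boundaryLayer p ν h b b, ‖w x‖ₑ * ENNReal.ofReal (h x ^ (-s))) +
          kernelTail n s (r / 2) * ∫⁻ x in Ω, ‖w x‖ₑ := by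
        calc ∫⁻ x in U ∩ Ω, F x
            ≤ ∫⁻ x in U ∩ Ω, (ENNReal.ofReal (L ^ s) * T * (‖w x‖ₑ * ENNReal.ofReal (h x ^ (-s))) +
              kernelTail n s (r / 2) * ‖w x‖ₑ) := by
              refine setLIntegral_mono' hUm fun x hx => ?_
              refine (mul_le_mul_right (hint x hx) _).trans_eq ?_
              ring
          _ = (∫⁻ x in U ∩ Ω, ENNReal.ofReal (L ^ s) * T * (‖w x‖ₑ * ENNReal.ofReal (h x ^ (-s)))) +
              ∫⁻ x in U ∩ Ω, kernelTail n s (r / 2) * ‖w x‖ₑ :=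
              lintegral_add_right _ (by fun_prop)
          _ ≤ _ := by
              rw [lintegral_const_mul' _ _ (ENNReal.mul_ne_top ENNReal.ofReal_ne_top hTt),
                lintegral_const_mul' _ _ (kernelTail_ne_top hs₀ (by linarith))]
              gcongr
              exact inter_subset_right
      refine ne_top_of_le_ne_top (ENNReal.add_ne_top.2 ⟨?_, ?_⟩) h1
      · exact ENNReal.mul_ne_top (ENNReal.mul_ne_top ENNReal.ofReal_ne_top hTt) hmain
      · exact ENNReal.mul_ne_top (kernelTail_ne_top hs₀ (by linarith)) hw1
  -- Finitely many of the local neighbourhoods cover the closure of Ω.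
  have hcomp : IsCompact (closure Ω) := hΩb.isCompact_closure
  have := hcomp.induction_on (p := fun A => ∫⁻ x in A ∩ Ω, F x ≠ ⊤) (by simp)
    (fun A B hAB hB => ne_top_of_le_ne_top hB
      (lintegral_mono_set (inter_subset_inter_left _ hAB)))
    (fun A B hA hB => by
      rw [union_inter_distrib_right]
      exact ne_top_of_le_ne_top (ENNReal.add_ne_top.2 ⟨hA, hB⟩) (lintegral_union_le _ _ _))
    hloc
  rwa [inter_eq_right.2 subset_closure] at this

/-- The Hardy inequality for w = 1, that is, finiteness of the s-perimeter of Ω. It bounds the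
energy of E₀ \ Ω for every datum E₀, so minimization never degenerates. -/
lemma interactionMeasure_compl_ne_top (hn : 1 ≤ n) (hs₀ : 0 < s) (hs₁ : s < 1) {Ω : Set 𝔼}
    (hΩo : IsOpen Ω) (hΩb : Bornology.IsBounded Ω) (hΩ : HasLipschitzBoundary Ω) :
    interactionMeasure n s (Ω ×ˢ Ωᶜ) ≠ ⊤ := by
  have h := lintegral_mul_interaction_compl_ne_top hn hs₀ hs₁ hΩo hΩb hΩ (w := fun _ => 1)
    measurable_const (by simpa using hΩb.measure_lt_top.ne) (by simp)
  rw [interactionMeasure_prod]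
  simpa using h

/-! ### Truncation and the coarea formula -/

/-- Truncation of a real number to the interval `[-N, N]`. -/
def clamp (N a : ℝ) : ℝ := max (-N) (min N a)

@[fun_prop]
lemma continuous_clamp (N : ℝ) : Continuous (clamp N) := by
  unfold clamp
  fun_prop

lemma abs_clamp_sub_le (N a b : ℝ) : |clamp N a - clamp N b| ≤ |a - b| := by
  have h1 := abs_max_sub_max_le_max (-N) (min N a) (-N) (min N b)
  have h2 := abs_min_sub_min_le_max N a N b
  rw [sub_self, abs_zero, max_eq_right (a := (0 : ℝ)) (abs_nonneg _)] at h1 h2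
  exact h1.trans h2

lemma clamp_eq_self {N a : ℝ} (h : |a| ≤ N) : clamp N a = a := by
  rw [clamp, min_eq_right (abs_le.1 h).2, max_eq_right (abs_le.1 h).1]

lemma volume_uIoc_inter_Ioc {N : ℝ} (hN : 0 ≤ N) (a b : ℝ) :
    volume (Set.uIoc a b ∩ Ioc (-N) N) = ENNReal.ofReal |clamp N a - clamp N b| := by
  wlog hab : a ≤ b generalizing a b
  · rw [uIoc_comm, abs_sub_comm]
    exact this b a (le_of_not_ge hab)
  rw [uIoc_of_le hab, Ioc_inter_Ioc, Real.volume_Ioc, clamp, clamp]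
  rcases le_total b (-N) with h1 | h1
  · rw [ENNReal.ofReal_of_nonpos (by simp [h1]), min_eq_right (by linarith),
      min_eq_right (by linarith),
      max_eq_left (by linarith), max_eq_left h1]
    simp
  rcases le_total N a with h2 | h2
  · rw [ENNReal.ofReal_of_nonpos (by simp [h2]), min_eq_left h2, min_eq_left (by linarith)]
    simp
  rw [min_eq_right h2, max_comm, min_comm b N, max_eq_right (a := -N) (b := min N b)
    (le_min (by linarith) h1), abs_sub_comm, abs_of_nonneg]
  rw [sub_nonneg]
  exact max_le (le_min (by linarith) h1) (le_min h2 hab)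

/-- The set {w ≥ t} separates the two points exactly when t lies in the half-open interval between
their values; the part of it in (-N, N] has length equal to the difference of the truncated values.
-/
lemma lintegral_separated_indicator {w : 𝔼 → ℝ} {N : ℝ} (hN : 0 ≤ N)
    (k : 𝔼 × 𝔼 → ℝ≥0∞) (p : 𝔼 × 𝔼) :
    ∫⁻ t in Ioc (-N) N, ({x | t ≤ w x} ×ˢ {x | t ≤ w x}ᶜ ∪
        {x | t ≤ w x}ᶜ ×ˢ {x | t ≤ w x}).indicator k p =
      ENNReal.ofReal |clamp N (w p.1) - clamp N (w p.2)| * k p := by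
  have e : ∀ t : ℝ, ({x | t ≤ w x} ×ˢ {x | t ≤ w x}ᶜ ∪
      {x | t ≤ w x}ᶜ ×ˢ {x | t ≤ w x}).indicator k p =
      (Set.uIoc (w p.1) (w p.2)).indicator (fun _ => k p) t := by
    intro t
    have : t ∈ Set.uIoc (w p.1) (w p.2) ↔ p ∈ ({x | t ≤ w x} ×ˢ {x | t ≤ w x}ᶜ ∪
        {x | t ≤ w x}ᶜ ×ˢ {x | t ≤ w x}) := by
      simp only [mem_uIoc, mem_union, mem_prod, mem_compl_iff, mem_ofPred_eq, not_le]
      tauto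
    by_cases ht : t ∈ Set.uIoc (w p.1) (w p.2)
    · rw [indicator_of_mem ht, indicator_of_mem (this.1 ht)]
    · rw [indicator_of_notMem ht, indicator_of_notMem fun h => ht (this.2 h)]
  simp_rw [e]
  rw [setLIntegral_indicator measurableSet_uIoc, setLIntegral_const, volume_uIoc_inter_Ioc hN,
    mul_comm]

/-- The coarea formula for truncations. -/
lemma lintegral_clamp_sub_eq {Ω : Set 𝔼} (hΩ : IsOpen Ω) {w : 𝔼 → ℝ} (hw : Measurable w) {N : ℝ}
    (hN : 0 ≤ N) :
    ∫⁻ p in crossRegion Ω, ENNReal.ofReal |clamp N (w p.1) - clamp N (w p.2)| *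
        fracKernel n s (p.1 - p.2) =
      ∫⁻ t in Ioc (-N) N, 2 * energy s Ω {x | t ≤ w x} := by
  set k : 𝔼 × 𝔼 → ℝ≥0∞ := fun p => fracKernel n s (p.1 - p.2) with hk
  have hE : ∀ t, MeasurableSet {x | t ≤ w x} := fun t => measurableSet_le measurable_const hw
  have hperim : ∀ t, 2 * energy s Ω {x | t ≤ w x} = ∫⁻ p in crossRegion Ω,
      ({x | t ≤ w x} ×ˢ {x | t ≤ w x}ᶜ ∪ {x | t ≤ w x}ᶜ ×ˢ {x | t ≤ w x}).indicator k p := by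
    intro t
    rw [← fracPerimeter_eq_energy hΩ (hE t).nullMeasurableSet, fracPerimeter]
    simp_rw [ofReal_abs_indicator_sub_div]
    rw [← mul_assoc, one_div, ENNReal.mul_inv_cancel two_ne_zero ENNReal.ofNat_ne_top, one_mul]
  simp_rw [hperim]
  rw [lintegral_lintegral_swap]
  · exact lintegral_congr fun p => (lintegral_separated_indicator hN k p).symm
  · have hS : MeasurableSet {q : ℝ × (𝔼 × 𝔼) | (q.1 ≤ w q.2.1 ∧ ¬ q.1 ≤ w q.2.2) ∨
        (¬ q.1 ≤ w q.2.1 ∧ q.1 ≤ w q.2.2)} := by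
      have h1 : MeasurableSet {q : ℝ × (𝔼 × 𝔼) | q.1 ≤ w q.2.1} :=
        measurableSet_le (by fun_prop) (by fun_prop)
      have h2 : MeasurableSet {q : ℝ × (𝔼 × 𝔼) | q.1 ≤ w q.2.2} :=
        measurableSet_le (by fun_prop) (by fun_prop)
      exact (h1.inter h2.compl).union (h1.compl.inter h2)
    have : (Function.uncurry fun (t : ℝ) (p : 𝔼 × 𝔼) => ({x | t ≤ w x} ×ˢ {x | t ≤ w x}ᶜ ∪
        {x | t ≤ w x}ᶜ ×ˢ {x | t ≤ w x}).indicator k p) =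
        {q : ℝ × (𝔼 × 𝔼) | (q.1 ≤ w q.2.1 ∧ ¬ q.1 ≤ w q.2.2) ∨
          (¬ q.1 ≤ w q.2.1 ∧ q.1 ≤ w q.2.2)}.indicator (fun q => k q.2) := by
      ext ⟨t, p⟩
      simp [indicator]
    rw [this]
    exact (Measurable.indicator (by fun_prop) hS).aemeasurable

lemma enorm_abs (a : ℝ) : ‖|a|‖ₑ = ‖a‖ₑ := by
  rw [← Real.norm_eq_abs, enorm_norm]

lemma enorm_div_rpow (a : ℝ) (x y : 𝔼) :
    ‖a / ‖x - y‖ ^ ((n : ℝ) + s)‖ₑ = ‖a‖ₑ * fracKernel n s (x - y) := by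
  rw [div_eq_mul_one_div, enorm_mul, fracKernel,
    Real.enorm_of_nonneg (r := 1 / ‖x - y‖ ^ ((n : ℝ) + s)) (by positivity)]

lemma gagliardoSeminorm_eq (Ω : Set 𝔼) (w : 𝔼 → ℝ) :
    gagliardoSeminorm s Ω w =
      ∫⁻ x in Ω, ∫⁻ y in Ω, ‖w x - w y‖ₑ * fracKernel n s (x - y) := by
  refine lintegral_congr fun x => lintegral_congr fun y => ?_
  rw [← enorm_div_rpow, ← Real.enorm_of_nonneg (by positivity), enorm_div_rpow, enorm_div_rpow,
    enorm_abs]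

lemma integrableOn_prod_of_lintegral {Ω₁ Ω₂ : Set 𝔼} {f : 𝔼 × 𝔼 → ℝ} (hf : Measurable f)
    (h : ∫⁻ x in Ω₁, ∫⁻ y in Ω₂, ‖f (x, y)‖ₑ ≠ ⊤) : IntegrableOn f (Ω₁ ×ˢ Ω₂) volume := by
  refine ⟨hf.aestronglyMeasurable, ?_⟩
  rw [HasFiniteIntegral, Measure.volume_eq_prod, ← Measure.prod_restrict,
    lintegral_prod _ (by fun_prop)]
  exact h.lt_top

lemma crossRegion_eq (Ω : Set 𝔼) : crossRegion Ω = Ω ×ˢ Ω ∪ (Ω ×ˢ Ωᶜ ∪ Ωᶜ ×ˢ Ω) := by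
  ext p
  simp only [crossRegion, mem_compl_iff, mem_prod, mem_union]
  tauto

/-! ### Comparing functions through their superlevel sets -/

section Comparison

variable {Ω : Set (EuclideanSpace ℝ (Fin n))} {u v : EuclideanSpace ℝ (Fin n) → ℝ}

/-- The integrand comparing the interaction energies of `u` and `v`. -/
noncomputable def energyDiff {n : ℕ} (s : ℝ) (u v : EuclideanSpace ℝ (Fin n) → ℝ)
    (p : EuclideanSpace ℝ (Fin n) × EuclideanSpace ℝ (Fin n)) : ℝ :=
  (|u p.1 - u p.2| - |v p.1 - v p.2|) / ‖p.1 - p.2‖ ^ ((n : ℝ) + s)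

/-- A majorant of the integrands comparing the truncations of `u` and `v`. -/
lemma exists_energyDiff_majorant (hn : 1 ≤ n) (hs₀ : 0 < s) (hs₁ : s < 1)
    (hΩo : IsOpen Ω) (hΩb : Bornology.IsBounded Ω) (hΩ : HasLipschitzBoundary Ω)
    (hu : Measurable u) (hv : Measurable v) (hu1 : IntegrableOn u Ω volume)
    (hv1 : IntegrableOn v Ω volume) (hGu : gagliardoSeminorm s Ω u ≠ ⊤)
    (hGv : gagliardoSeminorm s Ω v ≠ ⊤) (huv : ∀ᵐ x, x ∈ Ωᶜ → u x = v x) :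
    ∃ g : 𝔼 × 𝔼 → ℝ, IntegrableOn g (crossRegion Ω) volume ∧
      ∀ N : ℝ, ∀ᵐ p ∂volume.restrict (crossRegion Ω),
        ‖energyDiff s (fun x => clamp N (u x)) (fun x => clamp N (v x)) p‖ ≤ g p := by
  set r : 𝔼 × 𝔼 → ℝ := fun p => ‖p.1 - p.2‖ ^ ((n : ℝ) + s) with hr
  have hr0 : ∀ p, 0 ≤ r p := fun p => by positivity
  have hG : ∀ f : 𝔼 → ℝ, Measurable f → gagliardoSeminorm s Ω f ≠ ⊤ →
      IntegrableOn (fun p => |f p.1 - f p.2| / r p) (Ω ×ˢ Ω) volume := by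
    intro f hf hGf
    refine integrableOn_prod_of_lintegral (by fun_prop) ?_
    rw [gagliardoSeminorm_eq] at hGf
    simpa only [hr, enorm_div_rpow, enorm_abs] using hGf
  have hwm : Measurable fun x => u x - v x := hu.sub hv
  have hw1 : ∫⁻ x in Ω, ‖u x - v x‖ₑ ≠ ⊤ := (hu1.sub hv1).2.ne
  have hwG : ∫⁻ x in Ω, ∫⁻ y in Ω, ‖(u x - v x) - (u y - v y)‖ₑ * fracKernel n s (x - y) ≠ ⊤ := by
    rw [gagliardoSeminorm_eq] at hGu hGv
    refine ne_top_of_le_ne_top (ENNReal.add_ne_top.2 ⟨hGu, hGv⟩) ?_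
    have hm : ∀ f : 𝔼 → ℝ, Measurable f →
        Measurable fun p : 𝔼 × 𝔼 => ‖f p.1 - f p.2‖ₑ * fracKernel n s (p.1 - p.2) :=
      fun f hf => by fun_prop
    rw [← lintegral_add_left (hm u hu).lintegral_prod_right']
    refine lintegral_mono fun x => ?_
    have hmx : Measurable fun y => ‖u x - u y‖ₑ * fracKernel n s (x - y) := by fun_prop
    refine le_trans (lintegral_mono fun y => ?_) (lintegral_add_left hmx _).le
    rw [← add_mul]
    gcongr
    calc ‖(u x - v x) - (u y - v y)‖ₑ = ‖(u x - u y) - (v x - v y)‖ₑ := by congr 1; ring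
      _ ≤ _ := enorm_sub_le
  -- Outside Ω the functions agree, so on Ω × Ωᶜ only |u - v| at the inner point remains. No
  -- integrability of the exterior datum is needed.
  have hhardy := lintegral_mul_interaction_compl_ne_top hn hs₀ hs₁ hΩo hΩb hΩ hwm hw1 hwG
  have h1 : IntegrableOn (fun p : 𝔼 × 𝔼 => |u p.1 - v p.1| / r p) (Ω ×ˢ Ωᶜ) volume := by
    refine integrableOn_prod_of_lintegral (by fun_prop) ?_
    simp only [hr, enorm_div_rpow, enorm_abs]
    refine ne_of_eq_of_ne (lintegral_congr fun x => ?_) hhardy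
    rw [lintegral_const_mul' _ _ enorm_ne_top]
  have h2 : IntegrableOn (fun p : 𝔼 × 𝔼 => |u p.2 - v p.2| / r p) (Ωᶜ ×ˢ Ω) volume := by
    have hswap : MeasurePreserving (MeasurableEquiv.prodComm : 𝔼 × 𝔼 ≃ᵐ 𝔼 × 𝔼) volume volume :=
      Measure.measurePreserving_swap
    have := (hswap.integrableOn_comp_preimage (MeasurableEquiv.measurableEmbedding _)).2 h1
    have e : (MeasurableEquiv.prodComm : 𝔼 × 𝔼 ≃ᵐ 𝔼 × 𝔼) ⁻¹' (Ω ×ˢ Ωᶜ) = Ωᶜ ×ˢ Ω := by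
      ext p
      exact and_comm
    rw [e] at this
    refine this.congr_fun (fun p _ => ?_) (hΩo.measurableSet.compl.prod hΩo.measurableSet)
    change |u p.2 - v p.2| / ‖p.2 - p.1‖ ^ ((n : ℝ) + s) =
      |u p.2 - v p.2| / ‖p.1 - p.2‖ ^ ((n : ℝ) + s)
    rw [norm_sub_rev]
  have hΩm := hΩo.measurableSet
  set g₀ : 𝔼 × 𝔼 → ℝ := (Ω ×ˢ Ω).indicator
    (fun p => |u p.1 - u p.2| / r p + |v p.1 - v p.2| / r p) with hg₀
  set g₁ : 𝔼 × 𝔼 → ℝ := (Ω ×ˢ Ωᶜ).indicator (fun p => |u p.1 - v p.1| / r p) with hg₁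
  set g₂ : 𝔼 × 𝔼 → ℝ := (Ωᶜ ×ˢ Ω).indicator (fun p => |u p.2 - v p.2| / r p) with hg₂
  have i₀ : Integrable g₀ volume :=
    (integrable_indicator_iff (hΩm.prod hΩm)).2 ((hG u hu hGu).add (hG v hv hGv))
  have i₁ : Integrable g₁ volume := (integrable_indicator_iff (hΩm.prod hΩm.compl)).2 h1
  have i₂ : Integrable g₂ volume := (integrable_indicator_iff (hΩm.compl.prod hΩm)).2 h2
  have n₀ : ∀ p, 0 ≤ g₀ p := indicator_nonneg fun p _ =>
    add_nonneg (div_nonneg (abs_nonneg _) (hr0 p)) (div_nonneg (abs_nonneg _) (hr0 p))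
  have n₁ : ∀ p, 0 ≤ g₁ p := indicator_nonneg fun p _ => div_nonneg (abs_nonneg _) (hr0 p)
  have n₂ : ∀ p, 0 ≤ g₂ p := indicator_nonneg fun p _ => div_nonneg (abs_nonneg _) (hr0 p)
  refine ⟨fun p => g₀ p + (g₁ p + g₂ p), (i₀.add (i₁.add i₂)).integrableOn, fun N => ?_⟩
  have a1 : ∀ᵐ p : 𝔼 × 𝔼, p.1 ∈ Ωᶜ → u p.1 = v p.1 := by
    rw [Measure.volume_eq_prod]
    exact Measure.quasiMeasurePreserving_fst.ae huv
  have a2 : ∀ᵐ p : 𝔼 × 𝔼, p.2 ∈ Ωᶜ → u p.2 = v p.2 := by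
    rw [Measure.volume_eq_prod]
    exact Measure.quasiMeasurePreserving_snd.ae huv
  filter_upwards [ae_restrict_of_ae a1, ae_restrict_of_ae a2,
    ae_restrict_mem (measurableSet_crossRegion hΩo)] with p hp1 hp2 hp
  rw [energyDiff, Real.norm_eq_abs, abs_div, abs_of_nonneg (hr0 p)]
  set cu1 := clamp N (u p.1)
  set cu2 := clamp N (u p.2)
  set cv1 := clamp N (v p.1)
  set cv2 := clamp N (v p.2)
  rw [crossRegion_eq] at hp
  rcases hp with hp | hp | hp
  · refine le_trans ?_ (le_add_of_nonneg_right (add_nonneg (n₁ p) (n₂ p)))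
    rw [hg₀, indicator_of_mem hp, ← add_div]
    refine div_le_div_of_nonneg_right ?_ (hr0 p)
    refine (abs_sub _ _).trans ?_
    rw [abs_abs, abs_abs]
    exact add_le_add (abs_clamp_sub_le _ _ _) (abs_clamp_sub_le _ _ _)
  · refine le_trans ?_ ((le_add_of_nonneg_right (n₂ p)).trans (le_add_of_nonneg_left (n₀ p)))
    rw [hg₁, indicator_of_mem hp]
    refine div_le_div_of_nonneg_right ?_ (hr0 p)
    have e : cu2 = cv2 := congrArg (clamp N) (hp2 hp.2)
    rw [e]
    refine (abs_abs_sub_abs_le_abs_sub _ _).trans ?_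
    rw [sub_sub_sub_cancel_right]
    exact abs_clamp_sub_le _ _ _
  · refine le_trans ?_ ((le_add_of_nonneg_left (n₁ p)).trans (le_add_of_nonneg_left (n₀ p)))
    rw [hg₂, indicator_of_mem hp]
    refine div_le_div_of_nonneg_right ?_ (hr0 p)
    have e : cu1 = cv1 := congrArg (clamp N) (hp1 hp.1)
    rw [e]
    refine (abs_abs_sub_abs_le_abs_sub _ _).trans ?_
    rw [sub_sub_sub_cancel_left, abs_sub_comm]
    exact abs_clamp_sub_le _ _ _

lemma measurable_energyDiff (hu : Measurable u) (hv : Measurable v) :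
    Measurable (energyDiff s u v) := by
  unfold energyDiff
  fun_prop

lemma lintegral_clamp_interaction_ne_top (hΩo : IsOpen Ω) (hu : Measurable u)
    {c : ℝ≥0∞} (hc : c ≠ ⊤) (huc : ∀ᵐ t : ℝ, energy s Ω {x | t ≤ u x} ≤ c) {N : ℝ} (hN : 0 ≤ N) :
    ∫⁻ p in crossRegion Ω, ENNReal.ofReal |clamp N (u p.1) - clamp N (u p.2)| *
        fracKernel n s (p.1 - p.2) ≠ ⊤ := by
  rw [lintegral_clamp_sub_eq hΩo hu hN]
  have : ∫⁻ _ in Ioc (-N) N, 2 * c ≠ ⊤ := by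
    rw [setLIntegral_const, Real.volume_Ioc]
    exact ENNReal.mul_ne_top (ENNReal.mul_ne_top ENNReal.ofNat_ne_top hc) ENNReal.ofReal_ne_top
  refine ne_top_of_le_ne_top this (lintegral_mono_ae (ae_restrict_of_ae ?_))
  filter_upwards [huc] with t ht
  gcongr

/-- If almost all superlevel sets of `u` have no more energy than those of `v`, then `u` has no
more energy than `v`. -/
lemma energyDiff_integrableOn_and_nonpos (hn : 1 ≤ n) (hs₀ : 0 < s) (hs₁ : s < 1)
    (hΩo : IsOpen Ω) (hΩb : Bornology.IsBounded Ω) (hΩ : HasLipschitzBoundary Ω)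
    (hu : Measurable u) (hv : Measurable v) (hu1 : IntegrableOn u Ω volume)
    (hv1 : IntegrableOn v Ω volume) (hGu : gagliardoSeminorm s Ω u ≠ ⊤)
    (hGv : gagliardoSeminorm s Ω v ≠ ⊤) (huv : ∀ᵐ x, x ∈ Ωᶜ → u x = v x)
    {c : ℝ≥0∞} (hc : c ≠ ⊤) (huc : ∀ᵐ t : ℝ, energy s Ω {x | t ≤ u x} ≤ c)
    (hle : ∀ᵐ t : ℝ, energy s Ω {x | t ≤ u x} ≤ energy s Ω {x | t ≤ v x}) :
    IntegrableOn (energyDiff s u v) (crossRegion Ω) volume ∧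
      ∫ p in crossRegion Ω, energyDiff s u v p ≤ 0 := by
  obtain ⟨g, hg, hbound⟩ :=
    exists_energyDiff_majorant hn hs₀ hs₁ hΩo hΩb hΩ hu hv hu1 hv1 hGu hGv huv
  set f : ℕ → 𝔼 × 𝔼 → ℝ := fun N =>
    energyDiff s (fun x => clamp N (u x)) (fun x => clamp N (v x)) with hf
  have hfm : ∀ N, Measurable (f N) := fun N =>
    measurable_energyDiff (by fun_prop) (by fun_prop)
  have hlim : ∀ p, Tendsto (fun N => f N p) atTop (𝓝 (energyDiff s u v p)) := by
    intro p
    refine tendsto_const_nhds.congr' ?_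
    filter_upwards [eventually_ge_atTop ⌈|u p.1|⌉₊, eventually_ge_atTop ⌈|u p.2|⌉₊,
      eventually_ge_atTop ⌈|v p.1|⌉₊, eventually_ge_atTop ⌈|v p.2|⌉₊] with N h1 h2 h3 h4
    simp only [hf, energyDiff, clamp_eq_self (Nat.ceil_le.1 h1), clamp_eq_self (Nat.ceil_le.1 h2),
      clamp_eq_self (Nat.ceil_le.1 h3), clamp_eq_self (Nat.ceil_le.1 h4)]
  have hint : IntegrableOn (energyDiff s u v) (crossRegion Ω) volume := by
    refine hg.mono' (measurable_energyDiff hu hv).aestronglyMeasurable ?_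
    filter_upwards [ae_all_iff.2 fun N : ℕ => hbound N] with p hp
    exact le_of_tendsto' (hlim p).norm fun N => hp N
  refine ⟨hint, ?_⟩
  have htend := tendsto_integral_of_dominated_convergence g
    (fun N => (hfm N).aestronglyMeasurable) hg (fun N => hbound N)
    (ae_of_all (volume.restrict (crossRegion Ω)) hlim)
  refine le_of_tendsto' htend fun N => ?_
  have hN : (0 : ℝ) ≤ N := Nat.cast_nonneg N
  set a : (𝔼 → ℝ) → 𝔼 × 𝔼 → ℝ := fun w p =>
    |clamp N (w p.1) - clamp N (w p.2)| / ‖p.1 - p.2‖ ^ ((n : ℝ) + s) with ha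
  have ham : ∀ w, Measurable w → Measurable (a w) := fun w hw => by fun_prop
  have ha0 : ∀ w p, 0 ≤ a w p := fun w p => by positivity
  have hal : ∀ w, ∫⁻ p in crossRegion Ω, ENNReal.ofReal (a w p) =
      ∫⁻ p in crossRegion Ω, ENNReal.ofReal |clamp N (w p.1) - clamp N (w p.2)| *
        fracKernel n s (p.1 - p.2) := fun w => by
    refine lintegral_congr fun p => ?_
    rw [← Real.enorm_of_nonneg (ha0 w p), ha, enorm_div_rpow, Real.enorm_of_nonneg (abs_nonneg _)]
  have hau : IntegrableOn (a u) (crossRegion Ω) volume := by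
    refine ⟨(ham u hu).aestronglyMeasurable, ?_⟩
    rw [hasFiniteIntegral_iff_ofReal (ae_of_all _ (ha0 u)), hal]
    exact (lintegral_clamp_interaction_ne_top hΩo hu hc huc hN).lt_top
  -- The truncated u has finite energy and f N is integrable, so the truncated v has finite energy
  -- too and the integral may be split.
  have hfN : IntegrableOn (f N) (crossRegion Ω) volume :=
    hg.mono' (hfm N).aestronglyMeasurable (hbound N)
  have hfa : ∀ p, f N p = a u p - a v p := fun p => by simp only [hf, ha, energyDiff, sub_div]
  have hav : IntegrableOn (a v) (crossRegion Ω) volume := by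
    refine (hau.sub hfN).congr (ae_of_all _ fun p => ?_)
    simp only [Pi.sub_apply, hfa]
    ring
  simp_rw [hfa]
  rw [integral_sub hau hav, sub_nonpos, integral_eq_lintegral_of_nonneg_ae (ae_of_all _ (ha0 u))
    (ham u hu).aestronglyMeasurable, integral_eq_lintegral_of_nonneg_ae (ae_of_all _ (ha0 v))
    (ham v hv).aestronglyMeasurable]
  refine ENNReal.toReal_mono ?_ ?_
  · exact ((hasFiniteIntegral_iff_ofReal (ae_of_all _ (ha0 v))).1 hav.2).ne
  · rw [hal, hal, lintegral_clamp_sub_eq hΩo hu hN, lintegral_clamp_sub_eq hΩo hv hN]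
    refine lintegral_mono_ae (ae_restrict_of_ae ?_)
    filter_upwards [hle] with t ht
    gcongr

end Comparison

/-! ### From minimal superlevel sets to a minimal function -/

/-- Competitors in the definition agree with E everywhere outside Ω; altering F there on a null set
achieves this without changing its energy. -/
lemma _root_.IsSMinimalSet.energy_le_of_ae {Ω E F : Set 𝔼} (hΩ : IsOpen Ω)
    (hE : IsSMinimalSet s Ω E) (hF : NullMeasurableSet F volume)
    (h : ∀ᵐ x, x ∈ Ωᶜ → (x ∈ F ↔ x ∈ E)) : energy s Ω E ≤ energy s Ω F := by
  have hE' := (isSMinimalSet_iff hΩ).1 hE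
  have hΩm := hΩ.measurableSet.nullMeasurableSet (μ := volume)
  have hcongr : (F ∩ Ω ∪ E \ Ω : Set 𝔼) =ᵐ[volume] F := by
    filter_upwards [h] with x hx
    refine propext ?_
    change (x ∈ F ∧ x ∈ Ω) ∨ (x ∈ E ∧ x ∉ Ω) ↔ x ∈ F
    have hx : x ∉ Ω → (x ∈ F ↔ x ∈ E) := hx
    tauto
  rw [← energy_congr hcongr]
  refine hE'.2.2 _ ((hF.inter hΩm).union (hE'.1.diff hΩm)) ?_
  ext x
  simp only [Set.mem_sdiff, mem_union, mem_inter_iff]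
  tauto

lemma energyDiff_congr_ae {u v u' v' : 𝔼 → ℝ} (hu : u =ᵐ[volume] u') (hv : v =ᵐ[volume] v') :
    energyDiff s u v =ᵐ[volume] energyDiff s u' v' := by
  have key : ∀ {f f' : 𝔼 → ℝ}, f =ᵐ[volume] f' →
      ∀ᵐ p : 𝔼 × 𝔼, f p.1 = f' p.1 ∧ f p.2 = f' p.2 := fun hf => by
    rw [Measure.volume_eq_prod]
    exact (Measure.quasiMeasurePreserving_fst.ae hf).and
      (Measure.quasiMeasurePreserving_snd.ae hf)
  filter_upwards [key hu, key hv] with p hp hq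
  rw [energyDiff, energyDiff, hp.1, hp.2, hq.1, hq.2]

lemma gagliardoSeminorm_congr_ae {Ω : Set 𝔼} {u u' : 𝔼 → ℝ} (hu : u =ᵐ[volume] u') :
    gagliardoSeminorm s Ω u = gagliardoSeminorm s Ω u' := by
  refine lintegral_congr_ae (ae_restrict_of_ae ?_)
  filter_upwards [hu] with x hx
  refine lintegral_congr_ae (ae_restrict_of_ae ?_)
  filter_upwards [hu] with y hy
  rw [hx, hy]

/-- A function that is bounded in `Ω` and whose superlevel sets are almost all `s`-minimal
(up to null sets) is an `s`-minimal function. -/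
lemma isSMinimalFunction_of_superlevel (hn : 1 ≤ n) (hs₀ : 0 < s) (hs₁ : s < 1) {Ω : Set 𝔼}
    (hΩo : IsOpen Ω) (hΩb : Bornology.IsBounded Ω) (hΩ : HasLipschitzBoundary Ω)
    {u : 𝔼 → ℝ} (hu : AEMeasurable u volume) {M : ℝ} (hM : ∀ x ∈ Ω, |u x| ≤ M)
    {E : ℝ → Set 𝔼} (hE : ∀ t, IsSMinimalSet s Ω (E t))
    (hEu : ∀ᵐ t : ℝ, E t =ᵐ[volume] {x | t ≤ u x}) : IsSMinimalFunction s Ω u := by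
  set u' := hu.mk u with hu'
  have hu'm : Measurable u' := hu.measurable_mk
  have huu' : u =ᵐ[volume] u' := hu.ae_eq_mk
  set c := interactionMeasure n s (Ω ×ˢ Ωᶜ) with hc
  have hct : c ≠ ⊤ := interactionMeasure_compl_ne_top hn hs₀ hs₁ hΩo hΩb hΩ
  have hEu' : ∀ᵐ t : ℝ, E t =ᵐ[volume] {x | t ≤ u' x} := by
    filter_upwards [hEu] with t ht
    refine ht.trans ?_
    filter_upwards [huu'] with x hx
    refine propext ?_
    change t ≤ u x ↔ t ≤ u' x
    rw [hx]
  -- Comparison with E_t \ Ω bounds all the energies by the same constant c.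
  have huc : ∀ᵐ t : ℝ, energy s Ω {x | t ≤ u' x} ≤ c := by
    filter_upwards [hEu'] with t ht
    rw [← energy_congr ht]
    have h1 := (isSMinimalSet_iff hΩo).1 (hE t)
    refine (h1.2.2 (E t \ Ω) (h1.1.diff hΩo.measurableSet.nullMeasurableSet) ?_).trans
      energy_diff_le
    rw [sdiff_sdiff, union_self]
  have hu1 : IntegrableOn u Ω volume := by
    refine Measure.integrableOn_of_bounded (M := M) hΩb.measure_lt_top.ne hu.aestronglyMeasurable ?_
    filter_upwards [ae_restrict_mem hΩo.measurableSet] with x hx using hM x hx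
  -- Truncation at height M does not change u on Ω, so the truncated energy over Q(Ω) controls the
  -- seminorm.
  have hG : gagliardoSeminorm s Ω u' ≠ ⊤ := by
    rcases eq_empty_or_nonempty Ω with h0 | ⟨x₀, hx₀⟩
    · simp [gagliardoSeminorm, h0]
    have hM0 : 0 ≤ M := (abs_nonneg _).trans (hM x₀ hx₀)
    refine ne_top_of_le_ne_top (lintegral_clamp_interaction_ne_top hΩo hu'm hct huc hM0) ?_
    have hM' : ∀ᵐ x, x ∈ Ω → |u' x| ≤ M := by
      filter_upwards [huu'] with x hx hxΩ
      rw [← hx]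
      exact hM x hxΩ
    refine le_trans (le_of_eq ?_) (lintegral_mono_set (show Ω ×ˢ Ω ⊆ crossRegion Ω from
      fun p hp hp' => hp'.1 hp.1))
    rw [gagliardoSeminorm_eq, Measure.volume_eq_prod, ← Measure.prod_restrict,
      lintegral_prod _ (by fun_prop)]
    refine lintegral_congr_ae ?_
    filter_upwards [ae_restrict_of_ae hM', ae_restrict_mem hΩo.measurableSet] with x hx hxΩ
    refine lintegral_congr_ae ?_
    filter_upwards [ae_restrict_of_ae hM', ae_restrict_mem hΩo.measurableSet] with y hy hyΩ
    rw [clamp_eq_self (hx hxΩ), clamp_eq_self (hy hyΩ), ← Real.enorm_of_nonneg (abs_nonneg _),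
      enorm_abs]
  refine ⟨⟨hu, hu1, by rw [gagliardoSeminorm_congr_ae huu']; exact hG.lt_top⟩,
    fun v hv huv => ?_⟩
  set v' := hv.1.mk v with hv'
  have hv'm : Measurable v' := hv.1.measurable_mk
  have hvv' : v =ᵐ[volume] v' := hv.1.ae_eq_mk
  have huv' : ∀ᵐ x, x ∈ Ωᶜ → u' x = v' x := by
    have := (ae_restrict_iff' hΩo.measurableSet.compl).1 huv
    filter_upwards [this, huu', hvv'] with x h1 h2 h3 hx
    rw [← h2, ← h3, h1 hx]
  have hle : ∀ᵐ t : ℝ, energy s Ω {x | t ≤ u' x} ≤ energy s Ω {x | t ≤ v' x} := by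
    filter_upwards [hEu'] with t ht
    rw [← energy_congr ht]
    refine (hE t).energy_le_of_ae hΩo (measurableSet_le measurable_const hv'm).nullMeasurableSet ?_
    filter_upwards [huv', ht] with x hx htx hxΩ
    have htx : x ∈ E t ↔ t ≤ u' x := iff_of_eq htx
    rw [htx, hx hxΩ]
  obtain ⟨h1, h2⟩ := energyDiff_integrableOn_and_nonpos hn hs₀ hs₁ hΩo hΩb hΩ hu'm hv'm
    (hu1.congr_fun_ae (ae_restrict_of_ae huu')) (hv.2.1.congr_fun_ae (ae_restrict_of_ae hvv')) hG
    (by rw [← gagliardoSeminorm_congr_ae hvv']; exact hv.2.2.ne) huv' hct huc hle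
  have hcongr : energyDiff s u v =ᵐ[volume.restrict (crossRegion Ω)] energyDiff s u' v' :=
    ae_restrict_of_ae (s := crossRegion Ω) (energyDiff_congr_ae (s := s) huu' hvv')
  exact ⟨h1.congr_fun_ae hcongr.symm, (integral_congr_ae hcongr).trans_le h2⟩

/-! ### The family of maximal sets attached to the datum -/

section Family

variable {Ω : Set (EuclideanSpace ℝ (Fin n))} {φ : EuclideanSpace ℝ (Fin n) → ℝ}
  {E : ℝ → Set (EuclideanSpace ℝ (Fin n))}

lemma nullMeasurableSet_superlevel_sdiff (hΩo : IsOpen Ω)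
    (hφ : AEMeasurable φ (volume.restrict Ωᶜ)) (t : ℝ) :
    NullMeasurableSet ({x | x ∈ Ωᶜ ∧ t ≤ φ x} \ Ω) volume := by
  have h1 : NullMeasurableSet (φ ⁻¹' Ici t) (volume.restrict Ωᶜ) :=
    hφ.nullMeasurable measurableSet_Ici
  rw [nullMeasurableSet_restrict hΩo.measurableSet.compl.nullMeasurableSet] at h1
  convert! h1 using 1
  ext x
  simp only [Set.mem_sdiff, mem_ofPred_eq, mem_compl_iff, mem_inter_iff, mem_preimage, mem_Ici]
  tauto

lemma measureClosure_antitone (hΩo : IsOpen Ω) (hΩb : Bornology.IsBounded Ω)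
    (hE : ∀ t : ℝ, IsMaximalSMinimalSet s Ω {x | x ∈ Ωᶜ ∧ t ≤ φ x} (E t)) {t t' : ℝ}
    (h : t ≤ t') {x : 𝔼} (hx : x ∈ Ω) (hxE : x ∈ measureClosure (E t')) :
    x ∈ measureClosure (E t) := by
  refine measureClosure_congr_of_inter hΩo ?_ hx hxE
  refine measure_mono_null inter_subset_left
    ((hE t).measure_diff_eq_zero hΩo hΩb.measure_lt_top.ne (hE t').1 ?_)
  exact fun y hy => ⟨⟨hy.1.1, h.trans hy.1.2⟩, hy.2⟩

lemma measureClosure_eq_of_maximal (hΩo : IsOpen Ω) (hΩb : Bornology.IsBounded Ω)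
    {D E₁ E₂ : Set 𝔼} (h₁ : IsMaximalSMinimalSet s Ω D E₁) (h₂ : IsMaximalSMinimalSet s Ω D E₂)
    {x : 𝔼} (hx : x ∈ Ω) : x ∈ measureClosure E₁ ↔ x ∈ measureClosure E₂ :=
  ⟨measureClosure_congr_of_inter hΩo (measure_mono_null inter_subset_left
      (h₂.measure_diff_eq_zero hΩo hΩb.measure_lt_top.ne h₁.1 subset_rfl)) hx,
    measureClosure_congr_of_inter hΩo (measure_mono_null inter_subset_left
      (h₁.measure_diff_eq_zero hΩo hΩb.measure_lt_top.ne h₂.1 subset_rfl)) hx⟩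

lemma notMem_measureClosure_of_bound (hn : 1 ≤ n) (hs₀ : 0 < s) (hΩo : IsOpen Ω)
    (hΩb : Bornology.IsBounded Ω) {Θ M t : ℝ} (hΘ : 2 * (4 : ℝ) ^ (1 / s) ≤ Θ)
    (hM : ∀ᵐ x, x ∈ thickening (Θ * diam Ω) Ω \ Ω → |φ x| ≤ M) {F : Set 𝔼}
    (hF : IsSMinimalSetWrt s Ω {x | x ∈ Ωᶜ ∧ t ≤ φ x} F) (ht : M < t) {x : 𝔼} (hx : x ∈ Ω) :
    x ∉ measureClosure F := by
  have h0 : volume (F ∩ Ω) = 0 := by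
    refine hF.1.measure_inter_eq_zero hn hs₀ hΩo hΩb hΘ ?_
    rw [measure_eq_zero_iff_ae_notMem]
    filter_upwards [hM] with y hy hyF
    have h1 : y ∈ {x | x ∈ Ωᶜ ∧ t ≤ φ x} \ Ω := hF.2 ▸ ⟨hyF.1, hyF.2.2⟩
    linarith [h1.1.2, (abs_le.1 (hy hyF.2)).2]
  intro hcl
  obtain ⟨δ, hδ, hball⟩ := Metric.isOpen_iff.1 hΩo x hx
  exact (hcl δ hδ).ne' (measure_mono_null (inter_subset_inter_right _ hball) h0)

/-- The complement of F is minimal and, since t ≤ -M ≤ φ a.e. in the collar, its datum is null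
there; hence F fills Ω up to a null set. -/
lemma mem_measureClosure_of_bound (hn : 1 ≤ n) (hs₀ : 0 < s) (hΩo : IsOpen Ω)
    (hΩb : Bornology.IsBounded Ω) {Θ M t : ℝ} (hΘ : 2 * (4 : ℝ) ^ (1 / s) ≤ Θ)
    (hM : ∀ᵐ x, x ∈ thickening (Θ * diam Ω) Ω \ Ω → |φ x| ≤ M) {F : Set 𝔼}
    (hF : IsSMinimalSetWrt s Ω {x | x ∈ Ωᶜ ∧ t ≤ φ x} F) (ht : t ≤ -M) {x : 𝔼} (hx : x ∈ Ω) :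
    x ∈ measureClosure F := by
  have h0 : volume (Fᶜ ∩ Ω) = 0 := by
    refine (hF.1.compl hΩo).measure_inter_eq_zero hn hs₀ hΩo hΩb hΘ ?_
    rw [measure_eq_zero_iff_ae_notMem]
    filter_upwards [hM] with y hy hyF
    refine hyF.1 (sdiff_subset (hF.2.symm ▸ ?_ : y ∈ F \ Ω))
    exact ⟨⟨hyF.2.2, by linarith [(abs_le.1 (hy hyF.2)).1]⟩, hyF.2.2⟩
  have huniv : x ∈ measureClosure (univ : Set 𝔼) := fun r hr => by
    rw [univ_inter]; exact measure_ball_pos _ _ hr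
  refine measureClosure_congr_of_inter hΩo ?_ hx huniv
  rwa [← compl_eq_univ_sdiff]

end Family

end FractionalPerimeter

/-! ### The main theorem -/

open FractionalPerimeter in
theorem mainTheorem8 (n : ℕ) (hn : 1 ≤ n) (s : ℝ) (hs₀ : 0 < s) (hs₁ : s < 1) :
    ∃ Θ : ℝ, 1 < Θ ∧
      ∀ Ω : Set (EuclideanSpace ℝ (Fin n)),
        IsOpen Ω → Bornology.IsBounded Ω → HasLipschitzBoundary Ω →
      ∀ φ : EuclideanSpace ℝ (Fin n) → ℝ,
        AEMeasurable φ (volume.restrict Ωᶜ) →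
        MemLp φ ⊤ (volume.restrict (thickening (Θ * diam Ω) Ω \ Ω)) →
      ∃ u : EuclideanSpace ℝ (Fin n) → ℝ,
        IsSMinimalFunction s Ω u ∧
        (∀ x ∈ Ωᶜ, u x = φ x) ∧
        (∀ t : ℝ, ∃ E : Set (EuclideanSpace ℝ (Fin n)),
          IsMaximalSMinimalSet s Ω {x | x ∈ Ωᶜ ∧ t ≤ φ x} E) ∧
        (∀ E : ℝ → Set (EuclideanSpace ℝ (Fin n)),
          (∀ t : ℝ, IsMaximalSMinimalSet s Ω {x | x ∈ Ωᶜ ∧ t ≤ φ x} (E t)) →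
          ∀ x ∈ Ω, IsLUB {t : ℝ | x ∈ measureClosure (E t)} (u x)) := by
  classical
  have h4 : (1 : ℝ) ≤ 4 ^ (1 / s) := Real.one_le_rpow (by norm_num) (by positivity)
  refine ⟨2 * 4 ^ (1 / s), by linarith, fun Ω hΩo hΩb hΩ φ hφ hφb => ?_⟩
  set Θ : ℝ := 2 * 4 ^ (1 / s) with hΘ
  have hΩm := hΩo.measurableSet
  have hex : ∀ t : ℝ, ∃ E : Set (EuclideanSpace ℝ (Fin n)),
      IsMaximalSMinimalSet s Ω {x | x ∈ Ωᶜ ∧ t ≤ φ x} E := fun t =>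
    exists_isMaximalSMinimalSet hΩo (nullMeasurableSet_superlevel_sdiff hΩo hφ t)
      (interactionMeasure_compl_ne_top hn hs₀ hs₁ hΩo hΩb hΩ)
  obtain ⟨M, hM⟩ : ∃ M : ℝ, ∀ᵐ x, x ∈ thickening (Θ * diam Ω) Ω \ Ω → |φ x| ≤ M := by
    refine ⟨(eLpNorm φ ⊤ (volume.restrict (thickening (Θ * diam Ω) Ω \ Ω))).toReal, ?_⟩
    rw [← ae_restrict_iff' (isOpen_thickening.measurableSet.diff hΩm)]
    have h1 := hφb.2.ne
    rw [eLpNorm_exponent_top] at h1 ⊢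
    filter_upwards [ae_le_eLpNormEssSup (f := φ)
      (μ := volume.restrict (thickening (Θ * diam Ω) Ω \ Ω))] with x hx
    have := ENNReal.toReal_mono h1 hx
    simpa using this
  choose E hE using hex
  set U : EuclideanSpace ℝ (Fin n) → ℝ := fun x => sSup {t : ℝ | x ∈ measureClosure (E t)} with hU
  have hlub : ∀ x ∈ Ω, IsLUB {t : ℝ | x ∈ measureClosure (E t)} (U x) := fun x hx =>
    isLUB_csSup ⟨-M, mem_measureClosure_of_bound hn hs₀ hΩo hΩb le_rfl hM (hE (-M)).1 le_rfl hx⟩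
      ⟨M, fun t ht => not_lt.1 fun hlt =>
        notMem_measureClosure_of_bound hn hs₀ hΩo hΩb le_rfl hM (hE t).1 hlt hx ht⟩
  have hUM : ∀ x ∈ Ω, |U x| ≤ M := fun x hx => abs_le.2
    ⟨(hlub x hx).1 (mem_measureClosure_of_bound hn hs₀ hΩo hΩb le_rfl hM (hE (-M)).1 le_rfl hx),
      (hlub x hx).2 fun t ht => not_lt.1 fun hlt =>
        notMem_measureClosure_of_bound hn hs₀ hΩo hΩb le_rfl hM (hE t).1 hlt hx ht⟩
  have hlt : ∀ x ∈ Ω, ∀ t : ℝ, t < U x → x ∈ measureClosure (E t) := fun x hx t ht => by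
    obtain ⟨t', ht', htt'⟩ := (lt_isLUB_iff (hlub x hx)).1 ht
    exact measureClosure_antitone hΩo hΩb hE htt'.le hx ht'
  -- By monotonicity in t, rational levels suffice, and measure-theoretic closures are closed sets.
  have hUm : Measurable (Ω.indicator U) := by
    refine measurable_of_Ioi fun t => ?_
    have e : Ω.indicator U ⁻¹' Ioi t =
        (Ω ∩ ⋃ q ∈ {q : ℚ | t < q}, measureClosure (E q)) ∪ (Ωᶜ ∩ {_x | t < 0}) := by
      ext x
      by_cases hx : x ∈ Ω
      · have : t < U x ↔ ∃ q : ℚ, t < q ∧ x ∈ measureClosure (E q) := by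
          constructor
          · intro h
            obtain ⟨q, hq1, hq2⟩ := exists_rat_btwn h
            exact ⟨q, hq1, hlt x hx q hq2⟩
          · rintro ⟨q, hq, hxq⟩
            exact hq.trans_le ((hlub x hx).1 hxq)
        simp [indicator, hx, this]
      · simp [indicator, hx]
    rw [e]
    refine (hΩm.inter ?_).union (hΩm.compl.inter (MeasurableSet.const _))
    exact MeasurableSet.biUnion (to_countable _) fun q _ =>
      (isClosed_measureClosure _).measurableSet
  set u : EuclideanSpace ℝ (Fin n) → ℝ := Ω.piecewise U φ with hu
  have huΩ : ∀ x ∈ Ω, u x = U x := fun x hx => piecewise_eq_of_mem _ _ _ hx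
  have huφ : ∀ x ∈ Ωᶜ, u x = φ x := fun x hx => piecewise_eq_of_notMem _ _ _ hx
  have hum : AEMeasurable u volume := by
    have e : u = Ω.indicator U + Ωᶜ.indicator φ := (indicator_add_compl_eq_piecewise U φ).symm
    rw [e]
    exact hUm.aemeasurable.add ((aemeasurable_indicator_iff hΩm.compl).2 hφ)
  -- In Ω, membership in the closure of E_t gives t ≤ u(x), while only t < u(x) gives it back. The
  -- level set {u = t} is null for all but countably many t, and these t are discarded.
  have hEu : ∀ᵐ t : ℝ, E t =ᵐ[volume] {x | t ≤ u x} := by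
    have hcount := Measure.countable_meas_level_set_pos₀ hum.nullMeasurable
    filter_upwards [hcount.ae_notMem volume] with t ht
    have ht0 : ∀ᵐ x, u x ≠ t := by
      have : volume {x | u x = t} = 0 := by simpa using ht
      exact measure_eq_zero_iff_ae_notMem.1 this
    filter_upwards [ht0, (hE t).1.1.ae_mem_measureClosure_iff hn hs₀ hs₁ hΩo] with x hxt hx
    refine propext ?_
    change x ∈ E t ↔ t ≤ u x
    by_cases hxΩ : x ∈ Ω
    · rw [← hx hxΩ, huΩ x hxΩ]
      rw [huΩ x hxΩ] at hxt
      exact ⟨fun h => (hlub x hxΩ).1 h, fun h => hlt x hxΩ t (lt_of_le_of_ne h hxt.symm)⟩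
    · rw [huφ x hxΩ]
      have h1 := Set.ext_iff.1 (hE t).1.2 x
      simp only [Set.mem_sdiff, mem_ofPred_eq, mem_compl_iff] at h1
      tauto
  refine ⟨u, isSMinimalFunction_of_superlevel hn hs₀ hs₁ hΩo hΩb hΩ hum
    (fun x hx => by rw [huΩ x hx]; exact hUM x hx) (fun t => (hE t).1.1) hEu, huφ,
    fun t => ⟨E t, hE t⟩, fun E' hE' x hx => ?_⟩
  rw [huΩ x hx]
  -- Maximal sets for the same datum differ by a null set, so u does not depend on the chosen
  -- family.
  have : {t : ℝ | x ∈ measureClosure (E' t)} = {t : ℝ | x ∈ measureClosure (E t)} := by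
    ext t
    exact measureClosure_eq_of_maximal hΩo hΩb (hE' t) (hE t) hx
  rw [this]
  exact hlub x hx
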